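/- Let $\mathbf{k}$ be an algebraically closed field of characteristic zero, let $M$ be a free abelian group of finite rank, and let $T = \operatorname{Spec} \mathbf{k}[M]$ be the algebraic torus with character lattice $M$; for $m \in M$ write $\chi^m \colon T \to \mathbb{G}_m$ for the corresponding character. Let $X$ be a quasi-affine $T$-toric variety over $\mathbf{k}$, that is, an irreducible normal quasi-affine variety endowed with a faithful (algebraic) $T$-action that has an open dense orbit. A $\mathbb{G}_a$-action on $X$, with induced homomorphism $\varepsilon \colon \mathbb{G}_a \to \operatorname{Aut}(X)$, is called homogeneous of weight $m \in M$ if $$h \circ \varepsilon(t) \circ h^{-1} = \varepsilon(\chi^m(h)\, t) \quad \text{for all } h \in T \text{ and all } t \in \mathbb{G}_a .$$ Let $D(X) \subset M$ be the set of all $m \in M$ such that there is a nontrivial homogeneous $\mathbb{G}_a$-action on $X$ of weight $m$. If $X$ is not isomorphic to $T$ (as a variety over $\mathbf{k}$), then $D(X)$ generates $M$ as a group. -/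

import Mathlib

open CategoryTheory AlgebraicGeometry MonoidalCategory MonObj
open scoped TensorProduct

universe u

noncomputable section

namespace ToricGa

/-! ### The additive group and the torus -/

/-- The bialgebra structure on `k[X]` in which `X` is primitive, that is,
`Δ X = X ⊗ 1 + 1 ⊗ X` and `ε X = 0`: the coordinate ring of the additive group. -/
instance polynomialBialgebra (k : Type u) [Field k] : Bialgebra k (Polynomial k) :=
  .ofAlgHom
    (Polynomial.aeval (Polynomial.X ⊗ₜ[k] 1 + 1 ⊗ₜ[k] Polynomial.X))
    (Polynomial.aeval 0)
    (by
      ext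
      simp [Algebra.TensorProduct.one_def, TensorProduct.add_tmul, TensorProduct.tmul_add,
        add_assoc])
    (by ext; simp)
    (by ext; simp)

variable (k : Type u) [Field k]

/-- The additive group `𝔾ₐ = Spec k[X]`, as a monoid object in `k`-schemes (an action of a group is
an action of its underlying monoid);
its multiplication is induced by `X ↦ X ⊗ 1 + 1 ⊗ X`. -/
abbrev Ga : Over (Spec (.of k)) := (Spec (.of (Polynomial k))).asOver (Spec (.of k))

/-- The algebraic torus `T = Spec k[M]` with character lattice `M` (for `M` free of finite rank),
a group object in `k`-schemes; its multiplication is induced by `χ^m ↦ χ^m ⊗ χ^m`. -/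
abbrev torus (M : Type u) [AddCommGroup M] : Over (Spec (.of k)) :=
  (Spec (.of (AddMonoidAlgebra k M))).asOver (Spec (.of k))

variable {k}

/-- The `k`-rational point of `Spec A` given by a `k`-algebra homomorphism `A → k`. -/
def algPoint {A : Type u} [CommRing A] [Algebra k A] (φ : A →ₐ[k] k) :
    𝟙_ (Over (Spec (.of k))) ⟶ (Spec (.of A)).asOver (Spec (.of k)) :=
  Over.homMk (Spec.map (CommRingCat.ofHom φ.toRingHom)) (by
    change Spec.map _ ≫ Spec.map _ = 𝟙 (Spec (.of k))
    rw [← Spec.map_comp, ← CommRingCat.ofHom_comp, ← Spec.map_id]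
    congr 1
    ext x
    exact φ.commutes x)

/-- The point of `𝔾ₐ(k) = k` with coordinate `t`. -/
def gaPoint (t : k) : 𝟙_ (Over (Spec (.of k))) ⟶ Ga k := algPoint (Polynomial.aeval t)

/-- The point of `T(k) = Hom(M, kˣ)` given by a homomorphism `h` from `M` to the multiplicative
group of `k`. The character `χ^m` of `T` takes the value `h m` at this point. -/
def torusPoint {M : Type u} [AddCommGroup M] (h : AddChar M k) :
    𝟙_ (Over (Spec (.of k))) ⟶ torus k M :=
  algPoint (AddMonoidAlgebra.lift k k M h.toMonoidHom)

/-! ### Actions -/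

/-- The endomorphism `x ↦ g x` of `X` given by a rational point `g` of a monoid `G` that acts
on `X`. -/
def actBy {G : Over (Spec (.of k))} [MonObj G] (X : Over (Spec (.of k))) [ModObj G X]
    (g : 𝟙_ (Over (Spec (.of k))) ⟶ G) : X ⟶ X :=
  (λ_ X).inv ≫ g ▷ X ≫ ModObj.smul (M := G) (X := X)

/-- The orbit map `g ↦ g x` from `G` to `X` of a rational point `x` of `X`. -/
def orbitMap (G : Over (Spec (.of k))) [MonObj G] {X : Over (Spec (.of k))} [ModObj G X]
    (x : 𝟙_ (Over (Spec (.of k))) ⟶ X) : G ⟶ X :=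
  (ρ_ G).inv ≫ G ◁ x ≫ ModObj.smul (M := G) (X := X)

variable {M : Type u} [AddCommGroup M]

/-- `X` is a `T`-toric variety for the torus `T` with character lattice `M`: a normal (integral)
variety over `k` with a faithful `T`-action that has an open dense orbit. -/
structure IsToric (X : Over (Spec (.of k))) [ModObj (torus k M) X] : Prop where
  isIntegral : IsIntegral X.left
  isSeparated : IsSeparated X.hom
  locallyOfFiniteType : LocallyOfFiniteType X.hom
  quasiCompact : QuasiCompact X.hom
  normal : ∀ x : X.left, IsIntegrallyClosed (X.left.presheaf.stalk x)
  faithful : ∀ h : AddChar M k, actBy X (torusPoint h) = 𝟙 X → h = 1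
  exists_open_orbit : ∃ x : 𝟙_ (Over (Spec (.of k))) ⟶ X,
    IsOpen (Set.range (orbitMap (torus k M) x).left) ∧
      Dense (Set.range (orbitMap (torus k M) x).left)

/-- The `𝔾ₐ`-action `ε` on `X` is homogeneous of weight `m` with respect to the torus `T`:
`h ∘ ε(t) ∘ h⁻¹ = ε(χ^m(h) t)` for all `h ∈ T(k)` and `t ∈ k`. -/
def IsHomogeneous (X : Over (Spec (.of k))) [ModObj (torus k M) X] [ModObj (Ga k) X]
    (m : M) : Prop :=
  ∀ (h : AddChar M k) (t : k),
    actBy X (torusPoint h⁻¹) ≫ actBy X (gaPoint t) ≫ actBy X (torusPoint h) =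
      actBy X (gaPoint (h m * t))

/-- The set `D(X)` of all weights `m ∈ M` of nontrivial homogeneous `𝔾ₐ`-actions on `X`. -/
def weights (X : Over (Spec (.of k))) [ModObj (torus k M) X] : Set M :=
  {m | ∃ _ : ModObj (Ga k) X, (∃ t : k, actBy X (gaPoint t) ≠ 𝟙 X) ∧ IsHomogeneous X m}

end ToricGa

end

/-! A dense orbit embeds Γ(X) into k[M] equivariantly. A translation-stable subspace of k[M] is
spanned by monomials, so Γ(X) = k[S] for a submonoid S of M (`exists_equivariant_openImmersion`),
and quasi-affineness makes X an equivariant open subscheme of Spec k[S]. The monoid S is not assumed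
finitely generated. What is available is a finite cover of X by sets D(χ^s) = Spec k[S[-s]] with s ∈
F ⊆ S. Each S[-s] is finitely generated because X is of finite type, and saturated because X is
normal. Gluing sections gives S = ⋂ S[-s]; faithfulness makes S generate M.

If every S[-s] were M, all charts would coincide with T. Since X is not T, some S[-s] is proper, and
it has a facet (`exists_facet`): for a suitable e = s + t with t ∈ S, the localization S[-e] is a
half-space {v ≥ 0} with v surjective onto ℤ and v(e) = 0.

A root d, meaning v(d) = -1 and u + d - e ∈ S whenever u ∈ S and v(u) > 0, gives the 𝔾ₐ-action χ^u ↦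
χ^u (1 + T χ^d)^{v(u)} on Spec k[S], homogeneous of weight -d. It fixes χ^e and is trivial modulo
χ^e. It therefore preserves D(χ^e) ⊆ X and does not move points outside D(χ^e), so it restricts to X
(`neg_mem_weights`).

Roots are plentiful (`exists_isRoot_generate`): for every m₀ with v(m₀) = -1, the element m₀ + n e
is a root for all large n. Differences of consecutive roots give e, hence every m₀ with v(m₀) = -1,
and these generate M. -/

noncomputable section

/-! ### Localizations and facets of submonoids of a lattice -/

namespace AddSubmonoid

variable {M : Type*} [AddCommGroup M]

/-- The localization `P[-e]` of a submonoid `P` of an abelian group. -/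
def invert (P : AddSubmonoid M) (e : M) : AddSubmonoid M where
  carrier := {m | ∃ n : ℕ, m + n • e ∈ P}
  zero_mem' := ⟨0, by simp⟩
  add_mem' := by
    rintro a b ⟨n, hn⟩ ⟨l, hl⟩
    refine ⟨n + l, ?_⟩
    convert P.add_mem hn hl using 1
    rw [add_smul]; abel

lemma mem_invert {P : AddSubmonoid M} {e m : M} : m ∈ P.invert e ↔ ∃ n : ℕ, m + n • e ∈ P :=
  Iff.rfl

lemma le_invert (P : AddSubmonoid M) (e : M) : P ≤ P.invert e := fun m hm => ⟨0, by simpa⟩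

lemma neg_mem_invert (P : AddSubmonoid M) (e : M) : -e ∈ P.invert e := ⟨1, by simp⟩

lemma invert_le_invert_add {P : AddSubmonoid M} (e : M) {p : M} (hp : p ∈ P) :
    P.invert e ≤ P.invert (e + p) := by
  rintro m ⟨n, hn⟩
  refine ⟨n, ?_⟩
  rw [smul_add, ← add_assoc]
  exact P.add_mem hn (P.nsmul_mem hp n)

/-- A submonoid of an abelian group is saturated if it contains every element that has a
positive multiple in it. -/
def IsSaturated (P : AddSubmonoid M) : Prop := ∀ (n : ℕ) (m : M), 0 < n → n • m ∈ P → m ∈ P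

lemma IsSaturated.invert {P : AddSubmonoid M} (hP : P.IsSaturated) {e : M} (he : e ∈ P) :
    (P.invert e).IsSaturated := by
  rintro n m hn ⟨l, hl⟩
  refine ⟨l, hP n _ hn ?_⟩
  obtain ⟨n, rfl⟩ := Nat.exists_eq_succ_of_ne_zero hn.ne'
  have := P.add_mem hl (P.nsmul_mem he (n * l))
  convert this using 1
  rw [smul_add, smul_smul, add_assoc, ← add_smul, Nat.succ_mul, add_comm (n * l)]

lemma FG.invert {P : AddSubmonoid M} (hP : P.FG) (e : M) : (P.invert e).FG := by
  have : P.invert e = P ⊔ AddSubmonoid.multiples (-e) := by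
    apply le_antisymm
    · rintro m ⟨n, hn⟩
      rw [AddSubmonoid.mem_sup]
      exact ⟨_, hn, n • (-e), AddSubmonoid.nsmul_mem _ (AddSubmonoid.mem_multiples _) _, by simp⟩
    · rw [sup_le_iff, AddSubmonoid.multiples_le]
      exact ⟨P.le_invert e, P.neg_mem_invert e⟩
  rw [this]
  exact hP.sup ⟨{-e}, by simp [AddSubmonoid.multiples_eq_closure]⟩

/-- The submodule of units of a submonoid of an abelian group. -/
def units' (P : AddSubmonoid M) : Submodule ℤ M :=
  AddSubgroup.toIntSubmodule
    { carrier := {m | m ∈ P ∧ -m ∈ P}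
      zero_mem' := by simp
      add_mem' := fun {a b} ha hb => ⟨P.add_mem ha.1 hb.1, by
        rw [neg_add]; exact P.add_mem ha.2 hb.2⟩
      neg_mem' := fun {a} ha => ⟨ha.2, by simpa using ha.1⟩ }

/-- By the ascending chain condition on subgroups of M, choose a proper localization with maximal
unit group. Inverting one more nonunit q enlarges the units, so it must give all of M.
Geometrically, only one codimension-one boundary stratum is left. -/
lemma exists_invert_maximal [Module.Finite ℤ M] {P : AddSubmonoid M} (hP : P ≠ ⊤) :
    ∃ e ∈ P, P.invert e ≠ ⊤ ∧
      ∀ q ∈ P.invert e, -q ∉ P.invert e → ∀ m, ∃ n : ℕ, m + n • q ∈ P.invert e := by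
  have hne : {U : Submodule ℤ M | ∃ e ∈ P, P.invert e ≠ ⊤ ∧ U = (P.invert e).units'}.Nonempty := by
    refine ⟨_, 0, P.zero_mem, ?_, rfl⟩
    contrapose! hP
    rw [eq_top_iff]
    intro m _
    have : m ∈ P.invert 0 := hP ▸ AddSubmonoid.mem_top m
    simpa [mem_invert] using this
  obtain ⟨_, ⟨e, he, hne, rfl⟩, hmax⟩ := WellFounded.has_min (wellFounded_gt (α := Submodule ℤ M)) _ hne
  refine ⟨e, he, hne, fun q hq hq' m => ?_⟩
  obtain ⟨n, hn⟩ := hq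
  by_cases htop : P.invert (e + (q + n • e)) = ⊤
  · have : m ∈ P.invert (e + (q + n • e)) := htop ▸ AddSubmonoid.mem_top m
    obtain ⟨l, hl⟩ := this
    refine ⟨l, l * (1 + n), ?_⟩
    convert hl using 1
    module
  · exfalso
    refine hmax _ ⟨_, P.add_mem he hn, htop, rfl⟩ ?_
    have hle := invert_le_invert_add e hn
    refine lt_of_le_of_ne (fun u hu => ⟨hle hu.1, hle hu.2⟩) fun heq => ?_
    have : q ∈ (P.invert e).units' := by
      rw [heq]
      refine ⟨hle ⟨n, hn⟩, 1, ?_⟩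
      convert P.nsmul_mem he (n + 1) using 1
      module
    exact hq' this.2

/-- Gordan's lemma in disguise: with generators G of P, the preimage is a projection of the
equalizer of two homomorphisms from ℕ^(J ⊕ G) to M, and such equalizers are finitely generated. -/
lemma FG.comap_nat {J : Type*} [Finite J] {P : AddSubmonoid M} (hP : P.FG)
    (f : (J → ℕ) →+ M) : (P.comap f).FG := by
  obtain ⟨G, rfl⟩ := hP
  let g : ((J ⊕ G) → ℕ) →+ M :=
    { toFun := fun c => ∑ x : G, c (Sum.inr x) • (x : M)
      map_zero' := by simp
      map_add' := fun a b => by simp [add_smul, Finset.sum_add_distrib] }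
  let pr : ((J ⊕ G) → ℕ) →+ (J → ℕ) :=
    { toFun := fun c i => c (Sum.inl i), map_zero' := rfl, map_add' := fun _ _ => rfl }
  have h := (AddSubmonoid.fg_eqLocusM (f.comp pr) g).map pr
  convert h using 1
  ext c
  simp only [AddSubmonoid.mem_comap, AddSubmonoid.mem_map]
  constructor
  · intro hc
    obtain ⟨d, hd⟩ := (AddSubmonoid.mem_closure_finset'.mp hc)
    refine ⟨Sum.elim c d, ?_, rfl⟩
    change f c = _
    simp [g, hd]
  · rintro ⟨d, hd, rfl⟩
    have : f (pr d) = g d := hd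
    rw [this]
    exact _root_.sum_mem fun x _ => AddSubmonoid.nsmul_mem _ (AddSubmonoid.subset_closure x.2) _

/-- The pairs (a, b) with a q - b q₀ ∈ Q form a finitely generated monoid, so the slope b/a attains
its maximum at a generator. If a q - b q₀ were not a unit there, some multiple of it would still
dominate q₀ and give a larger slope. Thus modulo units Q has only one rational direction. In the
code, `true` indexes a and `false` indexes b. -/
lemma exists_smul_sub_mem_units {Q : AddSubmonoid M} (hfg : Q.FG) {q₀ : M} (h₀ : q₀ ∈ Q)
    (h₀' : -q₀ ∉ Q) (H : ∀ q ∈ Q, -q ∉ Q → ∃ n : ℕ, -q₀ + n • q ∈ Q) {q : M} (hq : q ∈ Q) :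
    ∃ a b : ℕ, 0 < a ∧ a • q - b • q₀ ∈ Q.units' := by
  let f : (Bool → ℕ) →+ M :=
    { toFun := fun c => c true • q - c false • q₀
      map_zero' := by simp
      map_add' := fun a b => by simp only [Pi.add_apply]; module }
  obtain ⟨G, hG⟩ := hfg.comap_nat f
  have hR (c : Bool → ℕ) : c ∈ AddSubmonoid.closure (G : Set (Bool → ℕ)) ↔
      c true • q - c false • q₀ ∈ Q := by rw [hG]; rfl
  -- No pair has infinite slope: -b q₀ ∈ Q with b > 0 would make q₀ a unit.
  have hzero : ∀ c ∈ AddSubmonoid.closure (G : Set (Bool → ℕ)), c true = 0 → c false = 0 := by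
    intro c hc hc0
    rw [hR, hc0, zero_smul, zero_sub] at hc
    by_contra hb
    obtain ⟨b, hb⟩ := Nat.exists_eq_succ_of_ne_zero hb
    apply h₀'
    rw [hb] at hc
    convert Q.add_mem hc (Q.nsmul_mem h₀ b) using 1
    rw [Nat.succ_eq_add_one]; module
  have hGne : (G.filter fun c => 0 < c true).Nonempty := by
    by_contra hcon
    rw [Finset.not_nonempty_iff_eq_empty, Finset.filter_eq_empty_iff] at hcon
    have : ∀ c ∈ AddSubmonoid.closure (G : Set (Bool → ℕ)), c true = 0 := by
      intro c hc
      induction hc using AddSubmonoid.closure_induction with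
      | mem x hx => have := hcon hx; omega
      | zero => rfl
      | add x y _ _ hx hy => simp [hx, hy]
    have h1 := this (fun b => if b then 1 else 0) (by rw [hR]; simpa)
    simp at h1
  obtain ⟨g, hg, hmax⟩ := Finset.exists_max_image _ (fun c : Bool → ℕ => (c false : ℚ) / c true) hGne
  rw [Finset.mem_filter] at hg
  have hslope : ∀ c ∈ AddSubmonoid.closure (G : Set (Bool → ℕ)),
      c false * g true ≤ g false * c true := by
    intro c hc
    induction hc using AddSubmonoid.closure_induction with
    | mem x hx =>
      rcases Nat.eq_zero_or_pos (x true) with h | h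
      · simp [hzero x (AddSubmonoid.subset_closure hx) h]
      · have := hmax x (Finset.mem_filter.mpr ⟨hx, h⟩)
        rw [div_le_div_iff₀ (by exact_mod_cast h) (by exact_mod_cast hg.2)] at this
        exact_mod_cast this
    | zero => simp
    | add x y _ _ hx hy => simp only [Pi.add_apply]; nlinarith
  have hgQ := (hR g).mp (AddSubmonoid.subset_closure hg.1)
  refine ⟨g true, g false, hg.2, hgQ, ?_⟩
  by_contra hcon
  obtain ⟨n, hn⟩ := H _ hgQ hcon
  -- The pair (n a, n b + 1) violates the maximality of the slope b/a.
  have := hslope (fun b => if b then n * g true else n * g false + 1) (by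
    rw [hR]
    simp only [if_true, Bool.false_eq_true, if_false]
    convert hn using 1
    module)
  simp only [if_true, Bool.false_eq_true, if_false] at this
  nlinarith [hg.2]

/-- A finitely generated saturated proper submonoid that generates a lattice has a facet. -/
theorem exists_facet [Module.Finite ℤ M] [Module.Free ℤ M] {P : AddSubmonoid M} (hfg : P.FG)
    (hsat : P.IsSaturated) (hgen : ∀ m : M, ∃ p ∈ P, ∃ q ∈ P, m = p - q) (hP : P ≠ ⊤) :
    ∃ (v : M →+ ℤ) (e : M), e ∈ P ∧ Function.Surjective v ∧ v e = 0 ∧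
      ∀ m, m ∈ P.invert e ↔ 0 ≤ v m := by
  obtain ⟨e, he, hne, hmax⟩ := exists_invert_maximal hP
  set Q := P.invert e with hQ
  have hQfg : Q.FG := hfg.invert e
  have hQsat : Q.IsSaturated := hsat.invert he
  obtain ⟨q₀, h₀, h₀'⟩ : ∃ q ∈ Q, -q ∉ Q := by
    by_contra! hcon
    apply hne
    rw [eq_top_iff]
    intro m _
    obtain ⟨p, hp, q, hq, rfl⟩ := hgen m
    rw [sub_eq_add_neg]
    exact Q.add_mem (P.le_invert e hp) (hcon _ (P.le_invert e hq))
  have key : ∀ m : M, ∃ (a : ℕ) (b : ℤ), 0 < a ∧ a • m - b • q₀ ∈ Q.units' := by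
    intro m
    obtain ⟨p, hp, q, hq, rfl⟩ := hgen m
    have H : ∀ q ∈ Q, -q ∉ Q → ∃ n : ℕ, -q₀ + n • q ∈ Q := fun q hq hq' => hmax q hq hq' _
    obtain ⟨a, b, ha, hab⟩ := exists_smul_sub_mem_units hQfg h₀ h₀' H (P.le_invert e hp)
    obtain ⟨c, d, hc, hcd⟩ := exists_smul_sub_mem_units hQfg h₀ h₀' H (P.le_invert e hq)
    refine ⟨a * c, b * c - d * a, Nat.mul_pos ha hc, ?_⟩
    convert Q.units'.sub_mem (Q.units'.smul_mem (c : ℤ) hab) (Q.units'.smul_mem (a : ℤ) hcd) using 1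
    module
  -- Saturation of Q passes to its units, so the quotient is torsion-free and hence a lattice.
  have htf : IsAddTorsionFree (M ⧸ Q.units') := by
    refine ⟨fun n hn x y hxy => ?_⟩
    obtain ⟨x, rfl⟩ := Q.units'.mkQ_surjective x
    obtain ⟨y, rfl⟩ := Q.units'.mkQ_surjective y
    simp only [← map_nsmul] at hxy
    simp only [Submodule.mkQ_apply, Submodule.Quotient.eq, ← smul_sub] at hxy ⊢
    exact ⟨hQsat n _ (Nat.pos_of_ne_zero hn) hxy.1,
      hQsat n _ (Nat.pos_of_ne_zero hn) (by simpa only [smul_neg] using hxy.2)⟩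
  have : Module.IsTorsionFree ℤ (M ⧸ Q.units') := inferInstance
  have : Module.Free ℤ (M ⧸ Q.units') := inferInstance
  let B := Module.Free.chooseBasis ℤ (M ⧸ Q.units')
  have hq₀ne : Submodule.Quotient.mk (p := Q.units') q₀ ≠ 0 := by
    rw [Ne, Submodule.Quotient.mk_eq_zero]
    exact fun h => h₀' h.2
  -- Any basis coordinate that is nonzero at q₀ serves as v up to sign: it is surjective, kills
  -- units, and by `key` the sign of v m is that of b in a m ≡ b q₀.
  obtain ⟨i, hi⟩ : ∃ i, B.repr (Submodule.Quotient.mk q₀) i ≠ 0 := by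
    by_contra! hcon
    exact hq₀ne (B.repr.map_eq_zero_iff.mp (Finsupp.ext hcon))
  obtain ⟨v, hvs, hvU, hv₀⟩ : ∃ v : M →+ ℤ, Function.Surjective v ∧ (∀ u ∈ Q.units', v u = 0) ∧
      0 < v q₀ := by
    let w : M →+ ℤ := ((B.coord i).comp Q.units'.mkQ).toAddMonoidHom
    have hws : Function.Surjective w := by
      intro n
      obtain ⟨m, hm⟩ := Q.units'.mkQ_surjective (n • B i)
      exact ⟨m, by simp [w, -Submodule.mkQ_apply, hm]⟩
    have hwU : ∀ u ∈ Q.units', w u = 0 := by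
      intro u hu
      have : Q.units'.mkQ u = 0 := by simpa using hu
      simp [w, -Submodule.mkQ_apply, this]
    rcases lt_or_gt_of_ne (show w q₀ ≠ 0 from hi) with h | h
    · exact ⟨-w, fun n => (hws (-n)).imp fun m hm => by simp [hm],
        fun u hu => by simp [hwU u hu], by simpa using h⟩
    · exact ⟨w, hws, hwU, h⟩
  refine ⟨v, e, he, hvs, hvU e ⟨P.le_invert e he, P.neg_mem_invert e⟩, fun m => ?_⟩
  obtain ⟨a, b, ha, hab⟩ := key m
  have hv : (a : ℤ) * v m = b * v q₀ := by
    have := hvU _ hab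
    simp only [map_sub, map_nsmul, map_zsmul, sub_eq_zero] at this
    simpa using this
  constructor
  · intro hm
    by_contra hcon
    have hb : b < 0 := by
      by_contra hb
      have : (0:ℤ) < a := by exact_mod_cast ha
      nlinarith
    obtain ⟨c, rfl⟩ := Int.exists_eq_neg_ofNat hb.le
    have h1 : -((c : ℕ) • q₀) ∈ Q := by
      have := Q.add_mem hab.2 (Q.nsmul_mem hm a)
      convert this using 1
      module
    exact h₀' (hQsat c (-q₀) (by omega) (by simpa using h1))
  · intro hm
    have hb : 0 ≤ b := by
      by_contra hb
      have : (0:ℤ) ≤ a := by positivity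
      nlinarith
    obtain ⟨c, rfl⟩ := Int.eq_ofNat_of_zero_le hb
    refine hQsat a m ha ?_
    have := Q.add_mem hab.1 (Q.nsmul_mem h₀ c)
    convert this using 1
    module

end AddSubmonoid

/-! ### Demazure roots and the group they generate -/

namespace AddSubmonoid

variable {M : Type*} [AddCommGroup M]

/-- `d` is a Demazure root of the submonoid `S` with respect to the functional `v`,
strictly positive along the element `e`. -/
structure IsRoot (S : AddSubmonoid M) (v : M →+ ℤ) (e d : M) : Prop where
  apply_eq : v d = -1
  add_sub_mem : ∀ u ∈ S, 0 < v u → u + d - e ∈ S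

/-- The facet of S[-s] comes with a denominator e in S[-s]; adding a multiple of s moves it into S.
The functional kills s, a unit of S[-s], so the half-space is unchanged. Having denominator s + t
ensures that D(χ^{s+t}) lies in the chart D(χ^s). -/
lemma exists_facet_of_cover [Module.Finite ℤ M] [Module.Free ℤ M] {S : AddSubmonoid M}
    (hgen : ∀ m : M, ∃ p ∈ S, ∃ q ∈ S, m = p - q) {s : M} (hs : s ∈ S)
    (hfg : (S.invert s).FG) (hsat : (S.invert s).IsSaturated) (hne : S.invert s ≠ ⊤) :
    ∃ (v : M →+ ℤ) (t : M), t ∈ S ∧ Function.Surjective v ∧ v (s + t) = 0 ∧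
      ∀ m, m ∈ S.invert (s + t) ↔ 0 ≤ v m := by
  obtain ⟨v, e, ⟨k, hk⟩, hv, hve, H⟩ := exists_facet hfg hsat (fun m => by
    obtain ⟨p, hp, q, hq, h⟩ := hgen m
    exact ⟨p, S.le_invert s hp, q, S.le_invert s hq, h⟩) hne
  have hpos : ∀ m ∈ S.invert s, 0 ≤ v m := fun m hm => (H m).mp (le_invert _ e hm)
  have hvs : v s = 0 := by
    have h1 := hpos _ (S.le_invert s hs)
    have h2 := hpos _ (S.neg_mem_invert s)
    rw [map_neg] at h2
    omega
  have hvt : v (s + (e + k • s)) = 0 := by simp [hvs, hve]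
  refine ⟨v, e + k • s, hk, hv, hvt, fun m => ⟨?_, fun hm => ?_⟩⟩
  · rintro ⟨n, hn⟩
    have := hpos _ (S.le_invert s hn)
    simpa only [map_add, map_nsmul, hvs, hve, smul_zero, add_zero] using this
  · obtain ⟨n, l, hl⟩ := (H m).mpr hm
    refine ⟨n + l, ?_⟩
    have := S.add_mem hl (S.add_mem (S.nsmul_mem hs (n * k + n)) (S.nsmul_mem hk l))
    convert this using 1
    module

/-- The point is that N does not depend on u. If v ≥ 0 on S[-s], it suffices to choose N for the
finitely many generators, since a sum with v > 0 has a summand with v > 0. Otherwise v(s) > 0, so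
v(m₀ + s) ≥ 0, and one N with m₀ + s + N e ∈ S works for every u. -/
lemma exists_forall_add_mem_invert {S : AddSubmonoid M} {v : M →+ ℤ} {e s m₀ : M} (he : e ∈ S)
    (H : ∀ m, m ∈ S.invert e ↔ 0 ≤ v m) (hm₀ : v m₀ = -1) (hfg : (S.invert s).FG) :
    ∃ N : ℕ, ∀ n ≥ N, ∀ u ∈ S, 0 < v u → u + m₀ + n • e ∈ S.invert s := by
  have hS : ∀ u ∈ S, 0 ≤ v u := fun u hu => (H u).mp (S.le_invert e hu)
  have hmono {N n : ℕ} (hn : N ≤ n) {x : M} (hx : x + N • e ∈ S.invert s) :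
      x + n • e ∈ S.invert s := by
    obtain ⟨l, rfl⟩ := Nat.exists_eq_add_of_le hn
    rw [add_smul, ← add_assoc]
    exact (S.invert s).add_mem hx ((S.invert s).nsmul_mem (S.le_invert s he) l)
  by_cases hpos : ∀ p ∈ S.invert s, 0 ≤ v p
  · obtain ⟨G, hG⟩ := hfg
    have : ∀ g : M, ∃ N : ℕ, 0 < v g → g + m₀ + N • e ∈ S := by
      intro g
      by_cases hg : 0 < v g
      · obtain ⟨N, hN⟩ := (H (g + m₀)).mpr (by rw [map_add]; omega)
        exact ⟨N, fun _ => hN⟩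
      · exact ⟨0, fun h => absurd h hg⟩
    choose N hN using this
    refine ⟨G.sup N, fun n hn u hu => ?_⟩
    have hu' : u ∈ closure (G : Set M) := hG ▸ S.le_invert s hu
    clear hu
    induction hu' using AddSubmonoid.closure_induction with
    | mem x hx => exact fun h => hmono ((Finset.le_sup hx).trans hn) (S.le_invert s (hN x h))
    | zero => simp
    | add x y hx hy hx' hy' =>
      rw [hG] at hx hy
      intro h
      rw [map_add] at h
      by_cases h1 : 0 < v x
      · convert (S.invert s).add_mem (hx' h1) hy using 1; abel
      · convert (S.invert s).add_mem hx (hy' (by omega)) using 1; abel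
  · push Not at hpos
    obtain ⟨p, ⟨k, hk⟩, hp⟩ := hpos
    have hvs : 0 < v s := by
      have := hS _ hk
      rw [map_add, map_nsmul, nsmul_eq_mul] at this
      by_contra hcon
      have : (k : ℤ) * v s ≤ 0 := mul_nonpos_of_nonneg_of_nonpos (by positivity) (by omega)
      omega
    obtain ⟨N, hN⟩ := (H (m₀ + s)).mpr (by rw [map_add]; omega)
    refine ⟨N, fun n hn u hu _ => hmono hn ⟨1, ?_⟩⟩
    convert S.add_mem hu hN using 1
    module

/-- The Demazure roots of a nontrivial toric cover generate the character lattice. -/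
theorem exists_isRoot_generate [Module.Finite ℤ M] [Module.Free ℤ M] {S : AddSubmonoid M}
    (hgen : ∀ m : M, ∃ p ∈ S, ∃ q ∈ S, m = p - q) (F : Finset M)
    (hfg : ∀ s ∈ F, (S.invert s).FG) (hF : ∀ m, (∀ s ∈ F, m ∈ S.invert s) → m ∈ S)
    {s : M} (hs : s ∈ S) (hsF : s ∈ F) (hsat : (S.invert s).IsSaturated)
    (hne : S.invert s ≠ ⊤) :
    ∃ (v : M →+ ℤ) (t : M), t ∈ S ∧ v (s + t) = 0 ∧ (∀ u ∈ S, 0 ≤ v u) ∧ (∃ u ∈ S, 0 < v u) ∧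
      ∀ H : AddSubgroup M, (∀ d, S.IsRoot v (s + t) d → -d ∈ H) → H = ⊤ := by
  obtain ⟨v, t, ht, hv, hvt, H⟩ := exists_facet_of_cover hgen hs (hfg s hsF) hsat hne
  have he := S.add_mem hs ht
  refine ⟨v, t, ht, hvt, fun u hu => (H u).mp (S.le_invert _ hu), ?_, fun K hK => ?_⟩
  · obtain ⟨m, hm⟩ := hv 1
    obtain ⟨n, hn⟩ := (H m).mpr (by omega)
    exact ⟨_, hn, by simp only [map_add, map_nsmul] at hvt ⊢; simp [hm, hvt]⟩
  set e := s + t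
  have hroot : ∀ m₀, v m₀ = -1 → ∃ N : ℕ, ∀ n ≥ N, m₀ + n • e ∈ K := by
    intro m₀ hm₀
    have := fun s (hs : s ∈ F) => exists_forall_add_mem_invert he H hm₀ (hfg s hs)
    choose! N hN using this
    -- The extra 1 pays for the `- e` in the definition of a root.
    refine ⟨F.sup N + 1, fun n hn => ?_⟩
    rw [← neg_neg (m₀ + n • e)]
    refine K.neg_mem (hK _ ⟨by simp [hm₀, hvt], fun u hu hvu => hF _ fun s hs => ?_⟩)
    obtain ⟨n, rfl⟩ := Nat.exists_eq_succ_of_ne_zero (show n ≠ 0 by omega)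
    convert hN s hs n ((Finset.le_sup hs).trans (by omega)) u hu hvu using 1
    rw [Nat.succ_eq_add_one]
    module
  have hmem : ∀ m₀, v m₀ = -1 → m₀ ∈ K := by
    intro m₀ hm₀
    obtain ⟨N, hN⟩ := hroot m₀ hm₀
    have h1 := hN N le_rfl
    have h2 := hN (N + 1) (by omega)
    have h3 : e ∈ K := by convert K.sub_mem h2 h1 using 1; module
    convert K.sub_mem h1 (K.nsmul_mem h3 N) using 1; module
  rw [eq_top_iff]
  intro m _
  obtain ⟨m₀, hm₀⟩ := hv (-1)
  -- The multiple of m₀ is chosen to bring the value of v to -1.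
  have h1 := hmem (m + (v m + 1) • m₀) (by simp [hm₀])
  convert K.sub_mem h1 (K.zsmul_mem (hmem m₀ hm₀) (v m + 1)) using 1
  module

end AddSubmonoid

/-! ### The coaction of the additive group attached to a root -/

namespace ToricGa

variable (k : Type u) [Field k] {M : Type u} [AddCommGroup M]

variable {k} in
lemma monoidAlgebra_algHom_ext {N : Type*} [AddMonoid N] {B : Type*} [Semiring B] [Algebra k B]
    {f g : AddMonoidAlgebra k N →ₐ[k] B}
    (h : ∀ m, f (AddMonoidAlgebra.single m 1) = g (AddMonoidAlgebra.single m 1)) : f = g :=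
  AddMonoidAlgebra.algHom_ext h (by ext)

/-- The inclusion of the algebra of a submonoid into the group algebra. -/
def inclM (S : AddSubmonoid M) : AddMonoidAlgebra k S →ₐ[k] AddMonoidAlgebra k M :=
  AddMonoidAlgebra.mapDomainAlgHom k k S.subtype

@[simp] lemma inclM_single (S : AddSubmonoid M) (u : S) (c : k) :
    inclM k S (AddMonoidAlgebra.single u c) = AddMonoidAlgebra.single (u : M) c :=
  AddMonoidAlgebra.mapDomain_single

lemma inclM_injective (S : AddSubmonoid M) : Function.Injective (inclM k S) :=
  AddMonoidAlgebra.mapDomain_injective Subtype.val_injective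

lemma map_id_injective {A B C : Type*} [CommRing A] [CommRing B] [CommRing C] [Algebra k A]
    [Algebra k B] [Algebra k C] {f : B →ₐ[k] C} (hf : Function.Injective f) :
    Function.Injective (Algebra.TensorProduct.map (AlgHom.id k A) f) :=
  Module.Flat.lTensor_preserves_injective_linearMap (M := A) f.toLinearMap hf

/-- The element `∑ binom(v u, n) Tⁿ ⊗ χ^{u + n d} = χ^u (1 + T χ^d)^{v u}`. -/
def rootExp (v : M →+ ℤ) (d u : M) : Polynomial k ⊗[k] AddMonoidAlgebra k M :=
  (1 ⊗ₜ AddMonoidAlgebra.single u 1) *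
    (Polynomial.X ⊗ₜ AddMonoidAlgebra.single d 1 + 1) ^ (v u).toNat

lemma rootExp_eq_sum (v : M →+ ℤ) (d u : M) :
    rootExp k v d u = ∑ n ∈ Finset.range ((v u).toNat + 1),
      (Polynomial.X ^ n) ⊗ₜ AddMonoidAlgebra.single (u + n • d) ((v u).toNat.choose n : k) := by
  rw [rootExp, (Commute.all _ _).add_pow, Finset.mul_sum]
  refine Finset.sum_congr rfl fun n _ => ?_
  have : ((((v u).toNat.choose n : ℕ)) : Polynomial k ⊗[k] AddMonoidAlgebra k M) =
      1 ⊗ₜ AddMonoidAlgebra.single 0 ((v u).toNat.choose n : k) := by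
    rw [← map_natCast (Algebra.TensorProduct.includeRight (R := k) (A := Polynomial k)
      (B := AddMonoidAlgebra k M))]
    simp [AddMonoidAlgebra.natCast_def]
  rw [this]
  simp [Algebra.TensorProduct.tmul_pow, AddMonoidAlgebra.single_pow,
    AddMonoidAlgebra.single_mul_single]

variable {k}

lemma counit_X : Coalgebra.counit (R := k) (Polynomial.X : Polynomial k) = 0 := by
  change Polynomial.aeval (0 : k) Polynomial.X = 0
  simp

lemma comul_X : Coalgebra.comul (R := k) (Polynomial.X : Polynomial k) =
    Polynomial.X ⊗ₜ 1 + 1 ⊗ₜ Polynomial.X := by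
  change Polynomial.aeval (R := k) _ Polynomial.X = _
  rw [Polynomial.aeval_X]

section Root

variable {S : AddSubmonoid M} {v : M →+ ℤ} {e d : M}

/-- Each addition of d lowers v by one, so the root condition can be iterated v(u) times. Hence all
terms of χ^u (1 + T χ^d)^{v(u)} stay in k[S], and those beyond the first are divisible by χ^e. -/
lemma add_nsmul_sub_mem (hd : S.IsRoot v e d) (he : e ∈ S) {u : M} (hu : u ∈ S) (n : ℕ)
    (hn : n < (v u).toNat) : u + (n + 1) • d - e ∈ S := by
  induction n with
  | zero => simpa using hd.add_sub_mem u hu (by omega)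
  | succ n ih =>
    have h1 := S.add_mem (ih (by omega)) he
    rw [sub_add_cancel] at h1
    have h2 := hd.add_sub_mem _ h1 (by
      rw [map_add, map_nsmul, hd.apply_eq]; simp; omega)
    convert h2 using 1
    module

lemma add_nsmul_mem (hd : S.IsRoot v e d) (he : e ∈ S) {u : M} (hu : u ∈ S) (n : ℕ)
    (hn : n ≤ (v u).toNat) : u + n • d ∈ S := by
  cases n with
  | zero => simpa
  | succ n => simpa using S.add_mem (add_nsmul_sub_mem hd he hu n hn) he

variable (k S) in
/-- The monomial with exponent `m`, or zero if `m` is not in `S`. -/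
def mon (m : M) (c : k) : AddMonoidAlgebra k S :=
  open Classical in if h : m ∈ S then AddMonoidAlgebra.single ⟨m, h⟩ c else 0

lemma mon_of_mem {m : M} (h : m ∈ S) (c : k) : mon k S m c = AddMonoidAlgebra.single ⟨m, h⟩ c := by
  simp [mon, h]

lemma mon_coe (m : S) (c : k) : mon k S m c = AddMonoidAlgebra.single m c :=
  mon_of_mem m.2 c

lemma inclM_mon {m : M} (h : m ∈ S) (c : k) : inclM k S (mon k S m c) = AddMonoidAlgebra.single m c := by
  rw [mon_of_mem h, inclM_single]

variable (k) in
/-- The root action as a homomorphism to the extension of the group algebra. -/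
def rootHom (hS : ∀ u ∈ S, 0 ≤ v u) (d : M) :
    AddMonoidAlgebra k S →ₐ[k] Polynomial k ⊗[k] AddMonoidAlgebra k M :=
  AddMonoidAlgebra.lift k _ S
    { toFun := fun u => rootExp k v d (u.toAdd : S)
      map_one' := by simp [rootExp, Algebra.TensorProduct.one_def, AddMonoidAlgebra.one_def]
      map_mul' := fun a b => by
        have ha := hS _ (a.toAdd : S).2
        have hb := hS _ (b.toAdd : S).2
        simp only [rootExp, toAdd_mul, AddSubmonoid.coe_add, map_add, Int.toNat_add ha hb, pow_add]
        have : (1 : Polynomial k) ⊗ₜ[k] (AddMonoidAlgebra.single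
            (((a.toAdd : S) : M) + ((b.toAdd : S) : M)) (1 : k)) =
            (1 ⊗ₜ AddMonoidAlgebra.single ((a.toAdd : S) : M) 1) *
            (1 ⊗ₜ AddMonoidAlgebra.single ((b.toAdd : S) : M) 1) := by
          simp [AddMonoidAlgebra.single_mul_single]
        rw [this]; ring }

lemma rootHom_single (hS : ∀ u ∈ S, 0 ≤ v u) (d : M) (u : S) :
    rootHom k hS d (AddMonoidAlgebra.single u 1) = rootExp k v d u := by
  simp [rootHom]

variable (k v d S) in
/-- The value of the root coaction on a monomial. -/
def rootSum (u : M) : Polynomial k ⊗[k] AddMonoidAlgebra k S :=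
  ∑ n ∈ Finset.range ((v u).toNat + 1),
    (Polynomial.X ^ n) ⊗ₜ mon k S (u + n • d) ((v u).toNat.choose n : k)

lemma map_rootSum (hd : S.IsRoot v e d) (he : e ∈ S) {u : M} (hu : u ∈ S) :
    Algebra.TensorProduct.map (AlgHom.id k (Polynomial k)) (inclM k S) (rootSum k S v d u) =
      rootExp k v d u := by
  rw [rootExp_eq_sum, rootSum, map_sum]
  refine Finset.sum_congr rfl fun n hn => ?_
  rw [Finset.mem_range] at hn
  simp [inclM_mon (add_nsmul_mem hd he hu n (by omega))]

lemma rootHom_mem_range (hS : ∀ u ∈ S, 0 ≤ v u) (hd : S.IsRoot v e d) (he : e ∈ S)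
    (a : AddMonoidAlgebra k S) : rootHom k hS d a ∈
      (Algebra.TensorProduct.map (AlgHom.id k (Polynomial k)) (inclM k S)).range := by
  induction a using AddMonoidAlgebra.induction_on with
  | of u =>
    change rootHom k hS d (AddMonoidAlgebra.single u 1) ∈ _
    rw [rootHom_single, ← map_rootSum hd he u.2]
    exact ⟨_, rfl⟩
  | add f g hf hg => rw [map_add]; exact add_mem hf hg
  | smul r f hf => rw [map_smul]; exact Subalgebra.smul_mem _ hf _

variable (k) in
/-- The coaction of the additive group on the algebra of `S` given by a root. -/
def coact (hS : ∀ u ∈ S, 0 ≤ v u) (hd : S.IsRoot v e d) (he : e ∈ S) :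
    AddMonoidAlgebra k S →ₐ[k] Polynomial k ⊗[k] AddMonoidAlgebra k S :=
  (AlgEquiv.ofInjective _ (map_id_injective k (A := Polynomial k) (inclM_injective k S))).symm.toAlgHom.comp
    ((rootHom k hS d).codRestrict _ (rootHom_mem_range hS hd he))

variable (hS : ∀ u ∈ S, 0 ≤ v u) (hd : S.IsRoot v e d) (he : e ∈ S)

lemma map_coact (a : AddMonoidAlgebra k S) :
    Algebra.TensorProduct.map (AlgHom.id k (Polynomial k)) (inclM k S) (coact k hS hd he a) =
      rootHom k hS d a := by
  have := (AlgEquiv.ofInjective _ (map_id_injective k (A := Polynomial k)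
    (inclM_injective k S))).apply_symm_apply
    ((rootHom k hS d).codRestrict _ (rootHom_mem_range hS hd he) a)
  exact congrArg Subtype.val this

lemma coact_single (u : S) :
    coact k hS hd he (AddMonoidAlgebra.single u 1) = rootSum k S v d u := by
  apply map_id_injective k (A := Polynomial k) (inclM_injective k S)
  rw [map_coact, rootHom_single, map_rootSum hd he u.2]

/-- The coaction is counital. -/
lemma coact_counit :
    (Algebra.TensorProduct.lid k (AddMonoidAlgebra k S)).toAlgHom.comp
      ((Algebra.TensorProduct.map (Bialgebra.counitAlgHom k (Polynomial k)) (AlgHom.id k _)).comp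
        (coact k hS hd he)) = AlgHom.id k _ := by
  refine monoidAlgebra_algHom_ext fun u => ?_
  simp only [AlgHom.comp_apply, coact_single, rootSum, map_sum]
  rw [Finset.sum_range_succ', Finset.sum_eq_zero]
  · simp [mon_coe]
  · intro n _
    simp [counit_X]

/-- The coaction is coassociative. -/
lemma coact_coassoc :
    (Algebra.TensorProduct.assoc k k k (Polynomial k) (Polynomial k) (AddMonoidAlgebra k S)).toAlgHom.comp
      ((Algebra.TensorProduct.map (Bialgebra.comulAlgHom k (Polynomial k)) (AlgHom.id k _)).comp
        (coact k hS hd he)) =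
    (Algebra.TensorProduct.map (AlgHom.id k (Polynomial k)) (coact k hS hd he)).comp
      (coact k hS hd he) := by
  refine monoidAlgebra_algHom_ext fun u => ?_
  -- The comparison is made over k[M], where d is an honest exponent and the binomial theorem
  -- applies to χ^u (X₁ χ^d + X₂ χ^d + 1)^{v(u)}.
  apply map_id_injective k (A := Polynomial k)
    (map_id_injective k (A := Polynomial k) (inclM_injective k S))
  have key (x : (Polynomial k ⊗[k] Polynomial k) ⊗[k] AddMonoidAlgebra k S) :
      Algebra.TensorProduct.map (AlgHom.id k (Polynomial k))
        (Algebra.TensorProduct.map (AlgHom.id k (Polynomial k)) (inclM k S))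
        (Algebra.TensorProduct.assoc k k k (Polynomial k) (Polynomial k) (AddMonoidAlgebra k S) x) =
      Algebra.TensorProduct.assoc k k k (Polynomial k) (Polynomial k) (AddMonoidAlgebra k M)
        (Algebra.TensorProduct.map (AlgHom.id k _) (inclM k S) x) := by
    induction x with
    | zero => simp
    | add x y hx hy => simp only [map_add, hx, hy]
    | tmul x y =>
      induction x with
      | zero => simp
      | add x x' hx hx' => simp only [TensorProduct.add_tmul, map_add, hx, hx']
      | tmul x x' => simp
  have key' (x : Polynomial k ⊗[k] AddMonoidAlgebra k S) :
      Algebra.TensorProduct.map (AlgHom.id k _) (inclM k S)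
        (Algebra.TensorProduct.map (Bialgebra.comulAlgHom k (Polynomial k)) (AlgHom.id k _) x) =
      Algebra.TensorProduct.map (Bialgebra.comulAlgHom k (Polynomial k)) (AlgHom.id k _)
        (Algebra.TensorProduct.map (AlgHom.id k _) (inclM k S) x) := by
    induction x with
    | zero => simp
    | add x y hx hy => simp only [map_add, hx, hy]
    | tmul x y => simp
  have hlhs : Algebra.TensorProduct.map (AlgHom.id k (Polynomial k))
      (Algebra.TensorProduct.map (AlgHom.id k (Polynomial k)) (inclM k S))
      (Algebra.TensorProduct.assoc k k k (Polynomial k) (Polynomial k) (AddMonoidAlgebra k S)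
        (Algebra.TensorProduct.map (Bialgebra.comulAlgHom k (Polynomial k)) (AlgHom.id k _)
          (rootSum k S v d u))) =
      (1 ⊗ₜ (1 ⊗ₜ AddMonoidAlgebra.single (u : M) 1)) *
        (Polynomial.X ⊗ₜ (1 ⊗ₜ AddMonoidAlgebra.single d 1) +
          1 ⊗ₜ (Polynomial.X ⊗ₜ AddMonoidAlgebra.single d 1 + 1)) ^ (v (u : M)).toNat := by
    rw [key, key', map_rootSum hd he u.2, rootExp]
    simp only [map_mul, map_pow, map_add, map_one, Algebra.TensorProduct.map_tmul, AlgHom.id_apply,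
      Bialgebra.comulAlgHom_apply, comul_X, TensorProduct.add_tmul, Algebra.TensorProduct.assoc_tmul,
      TensorProduct.tmul_add, ← Algebra.TensorProduct.one_def, add_assoc]
    simp only [Algebra.TensorProduct.one_def, Algebra.TensorProduct.assoc_tmul]
  -- Since v(u + n d) = v(u) - n, coacting on the n-th monomial yields exactly the remaining power
  -- in the n-th binomial term.
  have hterm : ∀ n ∈ Finset.range ((v (u : M)).toNat + 1),
      Algebra.TensorProduct.map (AlgHom.id k (Polynomial k)) (inclM k S)
        (coact k hS hd he (mon k S (u + n • d) ((v (u : M)).toNat.choose n : k))) =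
      ((v (u : M)).toNat.choose n : k) • (1 ⊗ₜ AddMonoidAlgebra.single (u + n • d) 1 *
        (Polynomial.X ⊗ₜ AddMonoidAlgebra.single d 1 + 1) ^ ((v (u : M)).toNat - n)) := by
    intro n hn
    rw [Finset.mem_range] at hn
    have hmem := add_nsmul_mem hd he u.2 n (by omega)
    rw [mon_of_mem hmem, ← _root_.mul_one ((v (u : M)).toNat.choose n : k), ← smul_eq_mul,
      ← AddMonoidAlgebra.smul_single, map_smul, map_smul, map_coact, rootHom_single, rootExp,
      smul_eq_mul, _root_.mul_one]
    congr 3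
    simp only [map_add, map_nsmul, hd.apply_eq]
    simp
    omega
  simp only [AlgHom.comp_apply, coact_single]
  refine (hlhs.trans (congrArg (_ * ·) (add_pow
    (R := Polynomial k ⊗[k] (Polynomial k ⊗[k] AddMonoidAlgebra k M)) _ _ _))).trans ?_
  rw [rootSum, map_sum, map_sum]
  refine (Finset.mul_sum _ _ _).trans ?_
  refine Finset.sum_congr rfl fun n hn => ?_
  rw [Algebra.TensorProduct.map_tmul, Algebra.TensorProduct.map_tmul, hterm n hn]
  simp only [AlgHom.id_apply, Algebra.TensorProduct.tmul_pow, TensorProduct.tmul_smul, one_pow,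
    AddMonoidAlgebra.single_pow]
  rw [← nsmul_eq_mul', ← Nat.cast_smul_eq_nsmul k, mul_smul_comm]
  congr 1
  simp only [Algebra.TensorProduct.tmul_mul_tmul, _root_.one_mul, _root_.mul_one]
  rw [← _root_.mul_assoc, Algebra.TensorProduct.tmul_mul_tmul, AddMonoidAlgebra.single_mul_single,
    _root_.one_mul, _root_.one_mul]

/-- The automorphism of the algebra of `S` given by the parameter `t`. -/
def coactAt (t : k) : AddMonoidAlgebra k S →ₐ[k] AddMonoidAlgebra k S :=
  (Algebra.TensorProduct.lid k (AddMonoidAlgebra k S)).toAlgHom.comp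
    ((Algebra.TensorProduct.map (Polynomial.aeval t) (AlgHom.id k _)).comp (coact k hS hd he))

lemma coactAt_single (t : k) (u : S) : coactAt hS hd he t (AddMonoidAlgebra.single u 1) =
    ∑ n ∈ Finset.range ((v u).toNat + 1),
      mon k S (u + n • d) (t ^ n * ((v u).toNat.choose n : k)) := by
  rw [coactAt, AlgHom.comp_apply, AlgHom.comp_apply, coact_single, rootSum, map_sum, map_sum]
  refine Finset.sum_congr rfl fun n _ => ?_
  by_cases h : (u : M) + n • d ∈ S <;> simp [mon, h]

variable (S) in
/-- The automorphism `χ^u ↦ h(u) χ^u` of the algebra of `S`. -/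
def translate (h : AddChar M k) : AddMonoidAlgebra k S →ₐ[k] AddMonoidAlgebra k S :=
  AddMonoidAlgebra.lift k _ S
    { toFun := fun u => AddMonoidAlgebra.single u.toAdd (h (u.toAdd : S))
      map_one' := by simp [AddMonoidAlgebra.one_def]
      map_mul' := fun a b => by
        simp [AddMonoidAlgebra.single_mul_single, AddChar.map_add_eq_mul] }

lemma translate_single (h : AddChar M k) (u : S) (c : k) :
    translate S h (AddMonoidAlgebra.single u c) = AddMonoidAlgebra.single u (c * h u) := by
  simp [translate]

/-- On the term χ^{u + n d} conjugation contributes h(u) h(-(u + n d)) = h(-d)^n, which is absorbed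
into t^n. This is why the weight is -d. -/
lemma coactAt_homogeneous (h : AddChar M k) (t : k) :
    (translate S h⁻¹).comp ((coactAt hS hd he t).comp (translate S h)) =
      coactAt hS hd he (h (-d) * t) := by
  refine monoidAlgebra_algHom_ext fun u => ?_
  simp only [AlgHom.comp_apply, translate_single, _root_.one_mul]
  rw [coactAt_single, show AddMonoidAlgebra.single u (h u) = h u • AddMonoidAlgebra.single u (1 : k) by
    simp, map_smul, coactAt_single, map_smul, map_sum, Finset.smul_sum]
  refine Finset.sum_congr rfl fun n hn => ?_
  rw [Finset.mem_range] at hn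
  have hmem := add_nsmul_mem hd he u.2 n (by omega)
  rw [mon_of_mem hmem, mon_of_mem hmem, translate_single, AddMonoidAlgebra.smul_single]
  congr 1
  have : h u * h (-(u : M)) = 1 := by
    rw [← AddChar.map_add_eq_mul, add_neg_cancel, AddChar.map_zero_eq_one]
  rw [AddChar.inv_apply, neg_add, AddChar.map_add_eq_mul, ← smul_neg, AddChar.map_nsmul_eq_pow,
    mul_pow, smul_eq_mul]
  linear_combination (t ^ n * ((v (u : M)).toNat.choose n : k) * h (-d) ^ n) * this

lemma coactAt_ne_id [CharZero k] (hpos : ∃ u ∈ S, 0 < v u) :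
    coactAt hS hd he (1 : k) ≠ AlgHom.id k _ := by
  obtain ⟨u, hu, hvu⟩ := hpos
  intro hcon
  have h1 := DFunLike.congr_fun hcon (AddMonoidAlgebra.single ⟨u, hu⟩ 1)
  rw [coactAt_single] at h1
  -- Evaluation at the unit of the torus turns the sum into 2^{v(u)}, which differs from 1 in
  -- characteristic zero.
  have h2 := congrArg (AddMonoidAlgebra.lift k k S 1) h1
  rw [map_sum] at h2
  have h3 : ∀ n ∈ Finset.range ((v u).toNat + 1), AddMonoidAlgebra.lift k k S 1
      (mon k S (u + n • d) (1 ^ n * ((v u).toNat.choose n : k))) = ((v u).toNat.choose n : k) := by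
    intro n hn
    rw [Finset.mem_range] at hn
    rw [mon_of_mem (add_nsmul_mem hd he hu n (by omega))]
    simp
  rw [Finset.sum_congr rfl h3, ← Nat.cast_sum, Nat.sum_range_choose] at h2
  simp only [AlgHom.coe_id, id_eq, AddMonoidAlgebra.lift_single, one_smul, MonoidHom.one_apply,
    Nat.cast_eq_one] at h2
  exact (Nat.one_lt_two_pow (show (v u).toNat ≠ 0 by omega)).ne' h2

lemma coact_single_of_apply_eq_zero {u : S} (hu : v u = 0) :
    coact k hS hd he (AddMonoidAlgebra.single u 1) = 1 ⊗ₜ AddMonoidAlgebra.single u 1 := by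
  rw [coact_single, rootSum]
  simp [hu, mon_coe]

/-- The `- e` in the root condition makes every term of positive degree in T divisible by χ^e, so
the action is trivial on the closed subset χ^e = 0. -/
lemma coact_sub_mem (a : AddMonoidAlgebra k S) : coact k hS hd he a - 1 ⊗ₜ a ∈
    Ideal.span {(1 : Polynomial k) ⊗ₜ[k] AddMonoidAlgebra.single (⟨e, he⟩ : S) (1 : k)} := by
  set I := Ideal.span {(1 : Polynomial k) ⊗ₜ[k] AddMonoidAlgebra.single (⟨e, he⟩ : S) (1 : k)}
  have : (Ideal.Quotient.mkₐ k I).comp (coact k hS hd he) =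
      (Ideal.Quotient.mkₐ k I).comp Algebra.TensorProduct.includeRight := by
    refine monoidAlgebra_algHom_ext fun u => ?_
    rw [AlgHom.comp_apply, AlgHom.comp_apply, Ideal.Quotient.mkₐ_eq_mk, Ideal.Quotient.eq,
      coact_single, rootSum, Finset.sum_range_succ']
    simp only [pow_zero, zero_smul, add_zero, Nat.choose_zero_right, Nat.cast_one, mon_coe,
      Algebra.TensorProduct.includeRight_apply, add_sub_cancel_right]
    refine sum_mem fun n hn => Ideal.mem_span_singleton.mpr ?_
    rw [Finset.mem_range] at hn
    have hmem := add_nsmul_sub_mem hd he u.2 n hn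
    refine ⟨(Polynomial.X ^ (n + 1)) ⊗ₜ AddMonoidAlgebra.single ⟨_, hmem⟩
      ((v (u : M)).toNat.choose (n + 1) : k), ?_⟩
    rw [mon_of_mem (add_nsmul_mem hd he u.2 (n + 1) hn), Algebra.TensorProduct.tmul_mul_tmul,
      AddMonoidAlgebra.single_mul_single, _root_.one_mul, _root_.one_mul]
    congr 2
    ext
    simp
  have h := DFunLike.congr_fun this a
  rwa [AlgHom.comp_apply, AlgHom.comp_apply, Ideal.Quotient.mkₐ_eq_mk, Ideal.Quotient.eq] at h

end Root

end ToricGa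

/-! ### From coactions on algebras to actions on affine schemes -/

namespace ToricGa

section Lax

open Functor

universe v₁ v₂ u₁ u₂

variable {C : Type u₁} [Category.{v₁} C] [MonoidalCategory C]
  {D : Type u₂} [Category.{v₂} D] [MonoidalCategory D]

attribute [local instance] Functor.monObjObj in
/-- A lax monoidal functor maps module objects to module objects. -/
abbrev mapModObj (F : C ⥤ D) [F.LaxMonoidal] (G X : C) [MonObj G] [ModObj G X] :
    ModObj (F.obj G) (F.obj X) where
  smul := LaxMonoidal.μ F G X ≫ F.map (ModObj.smul (M := G) (X := X))
  one_smul := by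
    change (LaxMonoidal.ε F ≫ F.map η) ▷ F.obj X ≫ LaxMonoidal.μ F G X ≫ F.map _ = (λ_ _).hom
    rw [comp_whiskerRight, Category.assoc, LaxMonoidal.μ_natural_left_assoc, ← F.map_comp,
      ModObj.one_smul_self, ← LaxMonoidal.left_unitality]
  mul_smul := by
    change (LaxMonoidal.μ F G G ≫ F.map μ) ▷ F.obj X ≫ LaxMonoidal.μ F G X ≫ F.map _ =
      (α_ _ _ _).hom ≫ F.obj G ◁ (LaxMonoidal.μ F G X ≫ F.map _) ≫ LaxMonoidal.μ F G X ≫ F.map _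
    rw [comp_whiskerRight, Category.assoc, LaxMonoidal.μ_natural_left_assoc, ← F.map_comp,
      ModObj.mul_smul_self, F.map_comp, F.map_comp, LaxMonoidal.associativity_assoc,
      MonoidalCategory.whiskerLeft_comp, Category.assoc, LaxMonoidal.μ_natural_right_assoc]

lemma lax_act (F : C ⥤ D) [F.LaxMonoidal] {G X : C} (φ : 𝟙_ C ⟶ G) (a : G ⊗ X ⟶ X) :
    (λ_ (F.obj X)).inv ≫ (LaxMonoidal.ε F ≫ F.map φ) ▷ F.obj X ≫ LaxMonoidal.μ F G X ≫ F.map a =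
      F.map ((λ_ X).inv ≫ φ ▷ X ≫ a) := by
  rw [comp_whiskerRight, Category.assoc, LaxMonoidal.μ_natural_left_assoc, F.map_comp, F.map_comp,
    ← LaxMonoidal.left_unitality_inv, Category.assoc, Category.assoc]

end Lax

variable {R : Type u} [CommRing R]

/-- A coaction of a bialgebra on a commutative algebra, as an action in the opposite category. -/
abbrev commAlgModObj {H A : Type u} [CommRing H] [Bialgebra R H] [CommRing A] [Algebra R A]
    (c : A →ₐ[R] H ⊗[R] A)
    (h₁ : (Algebra.TensorProduct.lid R A).toAlgHom.comp
      ((Algebra.TensorProduct.map (Bialgebra.counitAlgHom R H) (AlgHom.id R _)).comp c) =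
        AlgHom.id R _)
    (h₂ : (Algebra.TensorProduct.assoc R R R H H A).toAlgHom.comp
      ((Algebra.TensorProduct.map (Bialgebra.comulAlgHom R H) (AlgHom.id R _)).comp c) =
      (Algebra.TensorProduct.map (AlgHom.id R H) c).comp c) :
    ModObj (Opposite.op (CommAlgCat.of R H)) (Opposite.op (CommAlgCat.of R A)) where
  smul := (CommAlgCat.ofHom c).op
  one_smul := by
    apply Quiver.Hom.unop_inj
    ext a
    apply (Algebra.TensorProduct.lid R A).injective
    exact (DFunLike.congr_fun h₁ a).trans (by change a = (1:R) • a; simp)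
  mul_smul := by
    apply Quiver.Hom.unop_inj
    ext a
    apply (Algebra.TensorProduct.assoc R R R H H A).injective
    refine (DFunLike.congr_fun h₂ a).trans ?_
    symm
    exact (Algebra.TensorProduct.assoc R R R H H A).apply_symm_apply _

instance algSpecOfBraided : (algSpec (.of R)).Braided := braidedAlgSpec (R := .of R)

/-- The affine scheme of an algebra, over the base. -/
abbrev specOver (R : Type u) [CommRing R] (A : Type u) [CommRing A] [Algebra R A] :
    Over (Spec (.of R)) :=
  (Spec (.of A)).asOver (Spec (.of R))

/-- The morphism of affine schemes given by an algebra homomorphism. -/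
def specMap {A B : Type u} [CommRing A] [Algebra R A] [CommRing B] [Algebra R B]
    (f : A →ₐ[R] B) : specOver R B ⟶ specOver R A :=
  (algSpec (.of R)).map (CommAlgCat.ofHom f).op

lemma specMap_comp {A B C : Type u} [CommRing A] [Algebra R A] [CommRing B] [Algebra R B]
    [CommRing C] [Algebra R C] (f : A →ₐ[R] B) (g : B →ₐ[R] C) :
    specMap (g.comp f) = specMap g ≫ specMap f :=
  (algSpec (.of R)).map_comp (CommAlgCat.ofHom g).op (CommAlgCat.ofHom f).op

lemma specMap_id {A : Type u} [CommRing A] [Algebra R A] :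
    specMap (AlgHom.id R A) = 𝟙 _ :=
  (algSpec (.of R)).map_id (.op (CommAlgCat.of R A))

/-- The action of an affine monoid scheme on an affine scheme given by a coaction. -/
abbrev specModObj {H A : Type u} [CommRing H] [Bialgebra R H] [CommRing A] [Algebra R A]
    (c : A →ₐ[R] H ⊗[R] A)
    (h₁ : (Algebra.TensorProduct.lid R A).toAlgHom.comp
      ((Algebra.TensorProduct.map (Bialgebra.counitAlgHom R H) (AlgHom.id R _)).comp c) =
        AlgHom.id R _)
    (h₂ : (Algebra.TensorProduct.assoc R R R H H A).toAlgHom.comp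
      ((Algebra.TensorProduct.map (Bialgebra.comulAlgHom R H) (AlgHom.id R _)).comp c) =
      (Algebra.TensorProduct.map (AlgHom.id R H) c).comp c) :
    ModObj (specOver R H) (specOver R A) :=
  letI := commAlgModObj c h₁ h₂
  mapModObj (algSpec (.of R)) (.op (CommAlgCat.of R H)) (.op (CommAlgCat.of R A))

variable {k : Type u} [Field k]

section

variable {H A : Type u} [CommRing H] [Bialgebra k H] [CommRing A] [Algebra k A]
    (c : A →ₐ[k] H ⊗[k] A)
    (h₁ : (Algebra.TensorProduct.lid k A).toAlgHom.comp
      ((Algebra.TensorProduct.map (Bialgebra.counitAlgHom k H) (AlgHom.id k _)).comp c) =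
        AlgHom.id k _)
    (h₂ : (Algebra.TensorProduct.assoc k k k H H A).toAlgHom.comp
      ((Algebra.TensorProduct.map (Bialgebra.comulAlgHom k H) (AlgHom.id k _)).comp c) =
      (Algebra.TensorProduct.map (AlgHom.id k H) c).comp c)

/-- This translates the action of a rational point into algebra: it is Spec of (φ ⊗ id) ∘ c. Only
the map c matters, so the lemma also computes translations on the torus. -/
lemma specAct_eq (c : A →ₐ[k] H ⊗[k] A) (φ : H →ₐ[k] k) :
    (λ_ (specOver k A)).inv ≫ (algPoint φ : _ ⟶ specOver k H) ▷ specOver k A ≫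
      Functor.LaxMonoidal.μ (algSpec (.of k)) (.op (CommAlgCat.of k H)) (.op (CommAlgCat.of k A)) ≫
        (algSpec (.of k)).map (CommAlgCat.ofHom c).op =
    specMap ((Algebra.TensorProduct.lid k A).toAlgHom.comp
      ((Algebra.TensorProduct.map φ (AlgHom.id k _)).comp c)) := by
  have hφ : (algPoint φ : _ ⟶ specOver k H) = Functor.LaxMonoidal.ε (algSpec (.of k)) ≫
      (algSpec (.of k)).map (X := 𝟙_ _) (Y := .op (CommAlgCat.of k H)) (CommAlgCat.ofHom φ).op := by
    apply Over.OverMorphism.ext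
    exact (Category.id_comp (Spec.map (CommRingCat.ofHom φ.toRingHom))).symm
  rw [hφ]
  exact lax_act (algSpec (.of k)) (G := .op (CommAlgCat.of k H)) (X := .op (CommAlgCat.of k A))
    (CommAlgCat.ofHom φ).op (CommAlgCat.ofHom c).op

lemma actBy_specModObj (φ : H →ₐ[k] k) :
    letI := specModObj c h₁ h₂
    actBy (specOver k A) (algPoint φ : _ ⟶ specOver k H) =
    specMap ((Algebra.TensorProduct.lid k A).toAlgHom.comp
      ((Algebra.TensorProduct.map φ (AlgHom.id k _)).comp c)) :=
  specAct_eq c φ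

end

end ToricGa

/-! ### Restriction of the root action to the open subscheme X -/

namespace ToricGa

section Restrict

universe v₁ u₁

variable {C : Type u₁} [Category.{v₁} C] [MonoidalCategory C]

/-- The restriction of an action to a subobject that it preserves. -/
abbrev restrictModObj {G X Y : C} [MonObj G] [ModObj G Y] (j : X ⟶ Y) [Mono j] (a : G ⊗ X ⟶ X)
    (ha : a ≫ j = G ◁ j ≫ ModObj.smul (M := G) (X := Y)) : ModObj G X where
  smul := a
  one_smul := by
    change η ▷ X ≫ a = (λ_ X).hom
    rw [← cancel_mono j, Category.assoc, ha, ← whisker_exchange_assoc, ModObj.one_smul_self,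
      leftUnitor_naturality]
  mul_smul := by
    change μ ▷ X ≫ a = (α_ G G X).hom ≫ G ◁ a ≫ a
    rw [← cancel_mono j]
    simp only [Category.assoc, ha]
    rw [← whisker_exchange_assoc, ModObj.mul_smul_self, ← whiskerLeft_comp_assoc, ha,
      whiskerLeft_comp_assoc, tensor_whiskerLeft]
    simp

end Restrict

variable {k : Type u} [Field k]

lemma actBy_comp {G X Y : Over (Spec (.of k))} [MonObj G] [ModObj G X] [ModObj G Y] (j : X ⟶ Y)
    (hj : ModObj.smul (M := G) (X := X) ≫ j = G ◁ j ≫ ModObj.smul (M := G) (X := Y))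
    (g : 𝟙_ (Over (Spec (.of k))) ⟶ G) : actBy X g ≫ j = j ≫ actBy Y g := by
  change ((λ_ X).inv ≫ g ▷ X ≫ _) ≫ j = j ≫ ((λ_ Y).inv ≫ g ▷ Y ≫ _)
  rw [Category.assoc, Category.assoc]
  erw [hj]
  rw [leftUnitor_inv_naturality_assoc, whisker_exchange_assoc]

variable {M : Type u} [AddCommGroup M] {S : AddSubmonoid M} {v : M →+ ℤ} {e d : M}
  (hS : ∀ u ∈ S, 0 ≤ v u) (hd : S.IsRoot v e d) (he : e ∈ S)

/-- Where χ^e vanishes, the action agrees with the projection. Elsewhere, χ^e is invariant because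
v(e) = 0, so the image remains in D(χ^e) ⊆ U. -/
lemma specMap_coact_mem (hve : v e = 0) (U : Set (PrimeSpectrum (AddMonoidAlgebra k S)))
    (hU : (PrimeSpectrum.basicOpen (AddMonoidAlgebra.single (⟨e, he⟩ : S) (1 : k)) : Set _) ⊆ U)
    (q : PrimeSpectrum (Polynomial k ⊗[k] AddMonoidAlgebra k S))
    (hq : PrimeSpectrum.comap (Algebra.TensorProduct.includeRight :
      AddMonoidAlgebra k S →ₐ[k] Polynomial k ⊗[k] AddMonoidAlgebra k S).toRingHom q ∈ U) :
    PrimeSpectrum.comap (coact k hS hd he).toRingHom q ∈ U := by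
  by_cases h : (1 : Polynomial k) ⊗ₜ[k] AddMonoidAlgebra.single (⟨e, he⟩ : S) (1 : k) ∈ q.asIdeal
  · convert hq using 1
    ext a
    have h1 := (Ideal.span_singleton_le_iff_mem _).mpr h (coact_sub_mem hS hd he a)
    change coact k hS hd he a ∈ q.asIdeal ↔ (1 : Polynomial k) ⊗ₜ[k] a ∈ q.asIdeal
    exact ⟨fun h2 => by simpa using q.asIdeal.sub_mem h2 h1, fun h2 => by
      simpa using q.asIdeal.add_mem h1 h2⟩
  · apply hU
    change coact k hS hd he _ ∉ q.asIdeal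
    rwa [coact_single_of_apply_eq_zero hS hd he (u := ⟨e, he⟩) hve]

/-- The image of a morphism to an affine scheme, as a set of prime ideals. -/
def locus {A : Type u} [CommRing A] [Algebra k A] {X : Over (Spec (.of k))}
    (j : X ⟶ specOver k A) : Set (PrimeSpectrum A) := Set.range j.left

/-- The action of the additive group on the affine toric scheme given by a root. -/
abbrev rootModObj : ModObj (Ga k) (specOver k (AddMonoidAlgebra k S)) :=
  specModObj (coact k hS hd he) (coact_counit hS hd he) (coact_coassoc hS hd he)

variable (k) in
/-- The action morphism given by a root. -/
def rootSmul : Ga k ⊗ specOver k (AddMonoidAlgebra k S) ⟶ specOver k (AddMonoidAlgebra k S) :=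
  (rootModObj hS hd he).smul

lemma exists_restrict (hve : v e = 0) {X : Over (Spec (.of k))}
    (j : X ⟶ specOver k (AddMonoidAlgebra k S)) [IsOpenImmersion j.left]
    (hU : (PrimeSpectrum.basicOpen (AddMonoidAlgebra.single (⟨e, he⟩ : S) (1 : k)) : Set _) ⊆
      locus j) :
    ∃ a : Ga k ⊗ X ⟶ X, a ≫ j = Ga k ◁ j ≫ rootSmul k hS hd he := by
  let f : Ga k ⊗ X ⟶ specOver k (AddMonoidAlgebra k S) := Ga k ◁ j ≫ rootSmul k hS hd he
  have hf : Set.range f.left ⊆ Set.range j.left := by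
    rintro _ ⟨z, rfl⟩
    let w := (pullbackSpecIso k (Polynomial k) (AddMonoidAlgebra k S)).hom ((Ga k ◁ j).left z)
    have hw : f.left z = Spec.map (CommRingCat.ofHom (coact k hS hd he).toRingHom) w := rfl
    rw [hw]
    refine specMap_coact_mem hS hd he hve (locus j) hU w ?_
    refine ⟨(CartesianMonoidalCategory.snd (Ga k) X).left z, ?_⟩
    have h1 : CartesianMonoidalCategory.snd (Ga k) X ≫ j =
      Ga k ◁ j ≫ CartesianMonoidalCategory.snd (Ga k) _ := by simp
    have h2 := congrArg (fun g => g.left z) h1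
    refine h2.trans ?_
    have h3 := pullbackSpecIso_hom_snd k (Polynomial k) (AddMonoidAlgebra k S)
    exact (congrArg (fun g => g ((Ga k ◁ j).left z)) h3).symm
  have hfac := IsOpenImmersion.lift_fac j.left f.left hf
  refine ⟨Over.homMk (IsOpenImmersion.lift j.left f.left hf) ?_, ?_⟩
  · rw [← Over.w j, ← Category.assoc, hfac, Over.w f]
  · apply Over.OverMorphism.ext
    exact hfac

instance mono_of_left {X Y : Over (Spec (.of k))} (j : X ⟶ Y) [Mono j.left] : Mono j :=
  Over.mono_of_mono_left j

/-- Homogeneity descends to X because j is a monomorphism. Nontriviality needs `hΓ`: distinct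
endomorphisms of k[S] remain distinct after restriction to X. -/
lemma neg_mem_weights [CharZero k] (hS : ∀ u ∈ S, 0 ≤ v u) (hd : S.IsRoot v e d) (he : e ∈ S)
    (hve : v e = 0) (hpos : ∃ u ∈ S, 0 < v u) {X : Over (Spec (.of k))} [ModObj (torus k M) X]
    (j : X ⟶ specOver k (AddMonoidAlgebra k S)) [IsOpenImmersion j.left]
    (hj : ∀ h : AddChar M k, actBy X (torusPoint h) ≫ j = j ≫ specMap (translate S h))
    (hΓ : ∀ f g : AddMonoidAlgebra k S →ₐ[k] AddMonoidAlgebra k S,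
      j ≫ specMap f = j ≫ specMap g → f = g)
    (hU : (PrimeSpectrum.basicOpen (AddMonoidAlgebra.single (⟨e, he⟩ : S) (1 : k)) : Set _) ⊆
      locus j) :
    -d ∈ weights (M := M) X := by
  obtain ⟨a, ha⟩ := exists_restrict hS hd he hve j hU
  let := rootModObj (k := k) hS hd he
  let := restrictModObj j a ha
  have hact (t : k) : actBy X (gaPoint t) ≫ j = j ≫ specMap (coactAt hS hd he t) := by
    refine (actBy_comp j ha (gaPoint t)).trans ?_
    congr 1
    exact actBy_specModObj _ _ _ _
  refine ⟨restrictModObj j a ha, ⟨1, fun h => ?_⟩, fun h t => ?_⟩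
  · have h1 := hact 1
    rw [h, Category.id_comp] at h1
    refine coactAt_ne_id hS hd he hpos (hΓ _ _ ?_)
    rw [← h1, specMap_id, Category.comp_id]
  · rw [← cancel_mono j, Category.assoc, Category.assoc, hj, reassoc_of% hact t, reassoc_of% hj h⁻¹,
      hact, ← coactAt_homogeneous hS hd he h t, specMap_comp, specMap_comp]

end ToricGa

/-! ### Global sections and orbit maps -/

namespace ToricGa

variable {k : Type u} [Field k]

lemma toSpecΓ_comp_injective {X : Scheme.{u}} {B : CommRingCat.{u}} {f g : B ⟶ Γ(X, ⊤)}
    (h : X.toSpecΓ ≫ Spec.map f = X.toSpecΓ ≫ Spec.map g) : f = g := by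
  have h1 := congrArg (fun f => (Scheme.ΓSpecIso B).inv ≫ f.appTop) h
  simpa using h1

lemma eq_toSpecΓ_comp {X : Scheme.{u}} {B : CommRingCat.{u}} (j : X ⟶ Spec B) :
    j = X.toSpecΓ ≫ Spec.map ((Scheme.ΓSpecIso B).inv ≫ j.appTop) := by
  rw [Spec.map_comp, ← Scheme.toSpecΓ_naturality_assoc, toSpecΓ_SpecMap_ΓSpecIso_inv,
    Category.comp_id]

/-- The algebra structure on the global sections of a scheme over a field. -/
instance gammaAlgebra (X : Over (Spec (.of k))) : Algebra k Γ(X.left, ⊤) :=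
  ((Scheme.ΓSpecIso (.of k)).inv ≫ X.hom.appTop).hom.toAlgebra

/-- The canonical morphism from a scheme over a field to the spectrum of its global sections. -/
def toSpecGamma (X : Over (Spec (.of k))) : X ⟶ specOver k Γ(X.left, ⊤) :=
  Over.homMk X.left.toSpecΓ (by
    change X.left.toSpecΓ ≫ Spec.map ((Scheme.ΓSpecIso (.of k)).inv ≫ X.hom.appTop) = X.hom
    exact (eq_toSpecΓ_comp X.hom).symm)

lemma toSpecGamma_comp_injective {X : Over (Spec (.of k))} {B : Type u} [CommRing B] [Algebra k B]
    {f g : B →ₐ[k] Γ(X.left, ⊤)} (h : toSpecGamma X ≫ specMap f = toSpecGamma X ≫ specMap g) :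
    f = g := by
  have h1 : X.left.toSpecΓ ≫ Spec.map (CommRingCat.ofHom f.toRingHom) =
    X.left.toSpecΓ ≫ Spec.map (CommRingCat.ofHom g.toRingHom) := congrArg (fun g => g.left) h
  have h2 := toSpecΓ_comp_injective h1
  ext b
  exact congrArg (fun f => f.hom b) h2

lemma exists_eq_toSpecGamma_comp {X : Over (Spec (.of k))} {B : Type u} [CommRing B] [Algebra k B]
    (j : X ⟶ specOver k B) : ∃ f : B →ₐ[k] Γ(X.left, ⊤), j = toSpecGamma X ≫ specMap f := by
  let φ : CommRingCat.of B ⟶ Γ(X.left, ⊤) := (Scheme.ΓSpecIso (.of B)).inv ≫ j.left.appTop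
  have hφ : j.left = X.left.toSpecΓ ≫ Spec.map φ := by
    exact eq_toSpecΓ_comp (B := .of B) j.left
  have hk : CommRingCat.ofHom (algebraMap k B) ≫ φ =
      (Scheme.ΓSpecIso (.of k)).inv ≫ X.hom.appTop := by
    have h1 : X.left.toSpecΓ ≫ Spec.map (CommRingCat.ofHom (algebraMap k B) ≫ φ) =
        X.left.toSpecΓ ≫ Spec.map ((Scheme.ΓSpecIso (.of k)).inv ≫ X.hom.appTop) := by
      rw [Spec.map_comp, ← Category.assoc, ← hφ]
      exact (Over.w j).trans (Over.w (toSpecGamma X)).symm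
    exact toSpecΓ_comp_injective h1
  refine ⟨{ φ.hom with commutes' := fun r => congrArg (fun f => f.hom r) hk }, ?_⟩
  apply Over.OverMorphism.ext
  exact hφ

lemma mem_basicOpen_iff {X : Over (Spec (.of k))} (a : Γ(X.left, ⊤)) (x : X.left) :
    x ∈ X.left.basicOpen a ↔ a ∉ ((toSpecGamma X).left x : PrimeSpectrum _).asIdeal := by
  rw [← Scheme.toSpecΓ_preimage_basicOpen]
  rfl

section Orbit

open CartesianMonoidalCategory

variable {G X : Over (Spec (.of k))} [MonObj G] [ModObj G X]

lemma actBy_eq_smul (g : 𝟙_ (Over (Spec (.of k))) ⟶ G) :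
    actBy X g = (toUnit X ≫ g) • (𝟙 X) := by
  rw [Hom.smul_def, actBy]
  change (λ_ X).inv ≫ g ▷ X ≫ _ = _
  rw [← Category.assoc]
  congr 1
  ext <;> simp

lemma orbitMap_eq_smul (x : 𝟙_ (Over (Spec (.of k))) ⟶ X) :
    orbitMap G x = (𝟙 G) • (toUnit G ≫ x) := by
  rw [Hom.smul_def, orbitMap]
  change (ρ_ G).inv ≫ G ◁ x ≫ _ = _
  rw [← Category.assoc]
  congr 1
  ext <;> simp

/-- This is g(g'x) = (gg')x, checked on generalized points. -/
lemma orbitMap_actBy (x : 𝟙_ (Over (Spec (.of k))) ⟶ X) (g : 𝟙_ (Over (Spec (.of k))) ⟶ G) :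
    orbitMap G x ≫ actBy X g = ((λ_ G).inv ≫ g ▷ G ≫ μ) ≫ orbitMap G x := by
  have h : (λ_ G).inv ≫ g ▷ G ≫ μ = (toUnit G ≫ g) * 𝟙 G := by
    rw [Hom.mul_def, ← Category.assoc]
    congr 1
    ext <;> simp
  rw [h, actBy_eq_smul, orbitMap_eq_smul, ModObj.comp_smul, ModObj.comp_smul, Category.comp_id,
    Category.comp_id, comp_toUnit_assoc, comp_toUnit_assoc, SemigroupAction.mul_smul]

end Orbit

variable {M : Type u} [AddCommGroup M]

/-- The automorphism `χ^u ↦ h(u) χ^u` of the group algebra. -/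
def translateM (h : AddChar M k) : AddMonoidAlgebra k M →ₐ[k] AddMonoidAlgebra k M :=
  AddMonoidAlgebra.lift k _ M
    { toFun := fun u => AddMonoidAlgebra.single u.toAdd (h u.toAdd)
      map_one' := by simp [AddMonoidAlgebra.one_def]
      map_mul' := fun a b => by
        simp [AddMonoidAlgebra.single_mul_single, AddChar.map_add_eq_mul] }

lemma translateM_single (h : AddChar M k) (u : M) (c : k) :
    translateM h (AddMonoidAlgebra.single u c) = AddMonoidAlgebra.single u (c * h u) := by
  simp [translateM]

lemma torusPoint_mul (h : AddChar M k) : (λ_ (torus k M)).inv ≫ torusPoint h ▷ torus k M ≫ μ =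
    specMap (translateM h) := by
  refine (specAct_eq (Bialgebra.comulAlgHom k (AddMonoidAlgebra k M))
    (AddMonoidAlgebra.lift k k M h.toMonoidHom)).trans ?_
  congr 1
  refine monoidAlgebra_algHom_ext fun u => ?_
  simp [translateM_single]

end ToricGa

/-! ### The ring of global sections is a monoid algebra -/

namespace ToricGa

variable {k : Type u} [Field k]

/-- A subspace of a monoid algebra that is stable under an operator acting on the monomials
with distinct eigenvalues is spanned by monomials. -/
lemma single_mem_of_stable {N : Type*} (c : N → k) (hc : Function.Injective c)
    (W : Submodule k (AddMonoidAlgebra k N))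
    (τ : AddMonoidAlgebra k N → AddMonoidAlgebra k N)
    (hτ : ∀ f m, (τ f).coeff m = c m * f.coeff m)
    (hW : ∀ f ∈ W, τ f ∈ W) (f : AddMonoidAlgebra k N) (hf : f ∈ W) (m : N)
    (hm : f.coeff m ≠ 0) : AddMonoidAlgebra.single m 1 ∈ W := by
  induction hn : f.coeff.support.card using Nat.strong_induction_on generalizing f with
  | _ n ih =>
  by_cases h : ∃ m' ≠ m, f.coeff m' ≠ 0
  · obtain ⟨m', hne, hm'⟩ := h
    -- This removes the monomial m' and creates no new one, while m survives because the eigenvalues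
    -- are distinct.
    let g := τ f - c m' • f
    have hg : g ∈ W := W.sub_mem (hW f hf) (W.smul_mem _ hf)
    have hgc : ∀ x, g.coeff x = (c x - c m') * f.coeff x := by
      intro x
      simp [g, hτ, sub_mul]
    refine ih g.coeff.support.card ?_ g hg ?_ rfl
    · rw [← hn]
      apply Finset.card_lt_card
      refine ⟨fun x hx => ?_, fun hsub => ?_⟩
      · rw [Finsupp.mem_support_iff, hgc] at hx
        exact Finsupp.mem_support_iff.mpr (right_ne_zero_of_mul hx)
      · have := hsub (Finsupp.mem_support_iff.mpr hm')
        rw [Finsupp.mem_support_iff, hgc] at this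
        simp at this
    · rw [hgc]
      exact mul_ne_zero (sub_ne_zero.mpr (hc.ne hne.symm)) hm
  · push Not at h
    have : AddMonoidAlgebra.single m 1 = (f.coeff m)⁻¹ • f := by
      ext x
      by_cases hx : x = m
      · subst hx; simp [hm]
      · simp [h x hx, Ne.symm hx, AddMonoidAlgebra.coeff_single]
    rw [this]
    exact W.smul_mem _ hf

/-- Send a basis of M to distinct primes in ℚ ⊆ k; the p-adic valuations recover the exponents. A
single such torus point already separates all characters, so stability under it forces monomial
spanning. -/
lemma exists_injective_addChar (k : Type u) [Field k] [CharZero k] (M : Type*) [AddCommGroup M]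
    [Module.Free ℤ M] [Module.Finite ℤ M] : ∃ h : AddChar M k, Function.Injective h := by
  let b := Module.Free.chooseBasis ℤ M
  let e := Fintype.equivFin (Module.Free.ChooseBasisIndex ℤ M)
  let p (i : Module.Free.ChooseBasisIndex ℤ M) : ℕ := Nat.nth Nat.Prime (e i)
  have hp (i) : (p i).Prime := Nat.prime_nth_prime _
  have hp0 (i) : (p i : ℚ) ≠ 0 := by exact_mod_cast (hp i).ne_zero
  have hpinj : Function.Injective p := fun i j hij =>
    e.injective (Fin.ext (Nat.nth_injective Nat.infinite_setOfPred_prime hij))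
  let q (m : M) : ℚ := ∏ i, (p i : ℚ) ^ (b.repr m i)
  have hq (m : M) (i) : padicValRat (p i) (q m) = b.repr m i := by
    have : Fact (p i).Prime := ⟨hp i⟩
    have hprod : ∀ s : Finset (Module.Free.ChooseBasisIndex ℤ M),
        padicValRat (p i) (∏ j ∈ s, (p j : ℚ) ^ (b.repr m j)) =
          ∑ j ∈ s, padicValRat (p i) ((p j : ℚ) ^ (b.repr m j)) := by
      intro s
      induction s using Finset.cons_induction with
      | empty => simp
      | cons a s ha ih =>
        rw [Finset.prod_cons, Finset.sum_cons, padicValRat.mul (zpow_ne_zero _ (hp0 a))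
          (Finset.prod_ne_zero_iff.mpr fun j _ => zpow_ne_zero _ (hp0 j)), ih]
    rw [hprod, Finset.sum_eq_single i]
    · rw [padicValRat.zpow, padicValRat.of_nat, padicValNat_self]; simp
    · intro j _ hji
      have : Fact (p j).Prime := ⟨hp j⟩
      rw [padicValRat.zpow, padicValRat.of_nat, padicValNat_primes (hpinj.ne hji.symm)]
      simp
    · simp
  refine ⟨{ toFun := fun m => (q m : k), map_zero_eq_one' := by simp [q], map_add_eq_mul' := ?_ },
    fun m m' hm => ?_⟩
  · intro m m'
    rw [← Rat.cast_mul]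
    congr 1
    simp only [q, map_add, Finsupp.add_apply]
    rw [← Finset.prod_mul_distrib]
    exact Finset.prod_congr rfl fun i _ => zpow_add₀ (hp0 i) _ _
  · have h1 : q m = q m' := Rat.cast_injective (α := k) hm
    exact b.repr.injective (Finsupp.ext fun i => by rw [← hq, h1, hq])

variable {M : Type u} [AddCommGroup M]

lemma translateM_coeff (h : AddChar M k) (f : AddMonoidAlgebra k M) (m : M) :
    (translateM h f).coeff m = h m * f.coeff m := by
  induction f using AddMonoidAlgebra.induction_linear with
  | zero => simp
  | add f g hf hg => simp [hf, hg, mul_add]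
  | single u a =>
    rw [translateM_single]
    by_cases hx : u = m
    · subst hx; simp [mul_comm]
    · simp [hx, AddMonoidAlgebra.coeff_single]

lemma translate_coeff {S : AddSubmonoid M} (h : AddChar M k) (f : AddMonoidAlgebra k S) (m : S) :
    (translate S h f).coeff m = h m * f.coeff m := by
  induction f using AddMonoidAlgebra.induction_linear with
  | zero => simp
  | add f g hf hg => simp [hf, hg, mul_add]
  | single u a =>
    rw [translate_single]
    by_cases hx : u = m
    · subst hx; simp [mul_comm]
    · simp [hx, AddMonoidAlgebra.coeff_single]

lemma inclM_translate (S : AddSubmonoid M) (h : AddChar M k) (f : AddMonoidAlgebra k S) :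
    inclM k S (translate S h f) = translateM h (inclM k S f) := by
  have : (inclM k S).comp (translate S h) = (translateM h).comp (inclM k S) :=
    monoidAlgebra_algHom_ext fun u => by simp [translate_single, translateM_single]
  exact DFunLike.congr_fun this f

lemma translate_translate_inv (S : AddSubmonoid M) (h : AddChar M k) :
    (translate S h).comp (translate S h⁻¹) = AlgHom.id k _ :=
  monoidAlgebra_algHom_ext fun u => by
    have : h (-(u : M)) * h u = 1 := by
      rw [← AddChar.map_add_eq_mul, neg_add_cancel, AddChar.map_zero_eq_one]
    simp [translate_single, this]

/-- A subalgebra of the group algebra that is stable under translations is a monoid algebra. -/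
lemma exists_algEquiv_of_stable [CharZero k] [Module.Free ℤ M] [Module.Finite ℤ M]
    {A : Type u} [CommRing A] [Algebra k A] (i : A →ₐ[k] AddMonoidAlgebra k M)
    (hi : Function.Injective i) (hst : ∀ (h : AddChar M k) (a : A), ∃ b, translateM h (i a) = i b) :
    ∃ (S : AddSubmonoid M) (α : AddMonoidAlgebra k S ≃ₐ[k] A), ∀ x, i (α x) = inclM k S x := by
  obtain ⟨h, hh⟩ := exists_injective_addChar k M
  let S : AddSubmonoid M :=
    { carrier := {m | AddMonoidAlgebra.single m 1 ∈ i.range}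
      zero_mem' := i.range.one_mem
      add_mem' := fun {a b} ha hb => by
        have := i.range.mul_mem ha hb
        rwa [AddMonoidAlgebra.single_mul_single, _root_.one_mul] at this }
  have hrange : (inclM k S).range = i.range := by
    apply le_antisymm
    · rintro _ ⟨x, rfl⟩
      induction x using AddMonoidAlgebra.induction_linear with
      | zero => simp
      | add f g hf hg => rw [map_add]; exact add_mem hf hg
      | single u a =>
        have := i.range.smul_mem u.2 a
        simpa using this
    · intro f hf
      have hmem : ∀ m, f.coeff m ≠ 0 → m ∈ S := fun m hm =>
        single_mem_of_stable h hh (Subalgebra.toSubmodule i.range) (translateM h)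
          (translateM_coeff h) (by
            rintro _ ⟨a, rfl⟩
            obtain ⟨b, hb⟩ := hst h a
            exact ⟨b, hb.symm⟩) f hf m hm
      rw [← AddMonoidAlgebra.sum_coeff_single f]
      refine sum_mem fun m hm => ?_
      exact ⟨AddMonoidAlgebra.single ⟨m, hmem m (Finsupp.mem_support_iff.mp hm)⟩ _,
        inclM_single _ _ _ _⟩
  refine ⟨S, ((AlgEquiv.ofInjective _ (inclM_injective k S)).trans
    (Subalgebra.equivOfEq _ _ hrange)).trans (AlgEquiv.ofInjective i hi).symm, fun x => ?_⟩
  have := (AlgEquiv.ofInjective i hi).apply_symm_apply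
    (Subalgebra.equivOfEq _ _ hrange (AlgEquiv.ofInjective _ (inclM_injective k S) x))
  exact congrArg Subtype.val this

lemma algSpec_full {A B : Type u} [CommRing A] [Algebra k A] [CommRing B] [Algebra k B]
    (f : specOver k B ⟶ specOver k A) : ∃ φ : A →ₐ[k] B, specMap φ = f := by
  obtain ⟨φ, hφ⟩ := Spec.map_surjective (R := .of A) (S := .of B) f.left
  have h1 : CommRingCat.ofHom (algebraMap k A) ≫ φ = CommRingCat.ofHom (algebraMap k B) := by
    apply Spec.map_injective
    rw [Spec.map_comp, hφ]
    exact Over.w f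
  refine ⟨{ φ.hom with commutes' := fun r => congrArg (fun f => f.hom r) h1 }, ?_⟩
  apply Over.OverMorphism.ext
  exact hφ

lemma specMap_injective {A B : Type u} [CommRing A] [Algebra k A] [CommRing B] [Algebra k B]
    {f g : A →ₐ[k] B} (h : specMap f = specMap g) : f = g := by
  have h1 : Spec.map (CommRingCat.ofHom f.toRingHom) = Spec.map (CommRingCat.ofHom g.toRingHom) :=
    congrArg (fun f => f.left) h
  have h2 := Spec.map_injective h1
  ext a
  exact congrArg (fun f => f.hom a) h2

/-- A quasi-affine toric scheme is an equivariant open subscheme of the spectrum of a monoid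
algebra, the monoid algebra being its algebra of global sections. -/
theorem exists_equivariant_openImmersion [CharZero k] [Module.Free ℤ M] [Module.Finite ℤ M]
    (X : Over (Spec (.of k))) [ModObj (torus k M) X] (hX : IsToric (M := M) X) :
    ∃ (S : AddSubmonoid M) (α : AddMonoidAlgebra k S ≃ₐ[k] Γ(X.left, ⊤)),
      ∀ h : AddChar M k, actBy X (torusPoint h) ≫ toSpecGamma X ≫ specMap α.toAlgHom =
        (toSpecGamma X ≫ specMap α.toAlgHom) ≫ specMap (translate S h) := by
  obtain ⟨x, -, hx⟩ := hX.exists_open_orbit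
  have := hX.isIntegral
  obtain ⟨i, hi⟩ := algSpec_full (orbitMap (torus k M) x ≫ toSpecGamma X)
  -- A section with zero pullback vanishes along the dense orbit, so its nonvanishing locus is
  -- empty, and X is reduced.
  have hinj : Function.Injective i := by
    rw [injective_iff_map_eq_zero]
    intro a ha
    rw [← basicOpen_eq_bot_iff, eq_bot_iff]
    intro y hy
    obtain ⟨_, hz, ⟨z, rfl⟩⟩ := hx.inter_open_nonempty _ (X.left.basicOpen a).isOpen ⟨y, hy⟩
    have h1 := (mem_basicOpen_iff a _).mp hz
    exfalso
    apply h1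
    have h2 : (toSpecGamma X).left ((orbitMap (torus k M) x).left z) = (specMap i).left z := by
      rw [hi]; rfl
    rw [h2]
    have h3 : i a ∈ PrimeSpectrum.asIdeal (R := AddMonoidAlgebra k M) z := by
      rw [ha]
      exact Ideal.zero_mem _
    exact h3
  have hact (h : AddChar M k) : ∃ g : Γ(X.left, ⊤) →ₐ[k] Γ(X.left, ⊤),
      actBy X (torusPoint h) ≫ toSpecGamma X = toSpecGamma X ≫ specMap g :=
    exists_eq_toSpecGamma_comp _
  choose g hg using hact
  -- Equivariance of the orbit map makes the image of i stable under translations.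
  have hgi (h : AddChar M k) : i.comp (g h) = (translateM h).comp i := by
    apply specMap_injective
    rw [specMap_comp, specMap_comp, hi, Category.assoc, ← hg, ← Category.assoc, orbitMap_actBy,
      torusPoint_mul, Category.assoc]
  obtain ⟨S, α, hα⟩ := exists_algEquiv_of_stable i hinj fun h a =>
    ⟨g h a, (DFunLike.congr_fun (hgi h) a).symm⟩
  refine ⟨S, α, fun h => ?_⟩
  rw [reassoc_of% hg h, Category.assoc, ← specMap_comp, ← specMap_comp]
  congr 2
  refine AlgHom.ext fun f => hinj ?_
  have := DFunLike.congr_fun (hgi h) (α f)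
  simp only [AlgHom.comp_apply] at this ⊢
  refine this.trans ?_
  rw [hα]
  refine (inclM_translate S h f).symm.trans (hα _).symm

end ToricGa

/-! ### Affine charts of X and gluing of fractions -/

namespace ToricGa

variable {k : Type u} [Field k]

section Chart

variable {R B : Type u} [CommRing R] [CommRing B] [Algebra k R] [Algebra k B] [Algebra R B]
  [IsScalarTower k R B] {X : Over (Spec (.of k))}

lemma exists_chart (j : X ⟶ specOver k R) [IsOpenImmersion j.left] (r : R)
    [IsLocalization.Away r B] (h : (PrimeSpectrum.basicOpen r : Set (PrimeSpectrum R)) ⊆ locus j) :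
    ∃ i : specOver k B ⟶ X, i ≫ j = specMap (IsScalarTower.toAlgHom k R B) ∧
      IsOpenImmersion i.left ∧ ∀ x : X.left, r ∉ (j.left x : PrimeSpectrum R).asIdeal →
        x ∈ Set.range i.left := by
  let f : Spec (.of B) ⟶ Spec (.of R) := Spec.map (CommRingCat.ofHom (algebraMap R B))
  have hfo : IsOpenImmersion f := IsOpenImmersion.of_isLocalization r
  have hfr : Set.range f = (PrimeSpectrum.basicOpen r : Set (PrimeSpectrum R)) :=
    PrimeSpectrum.localization_away_comap_range B r
  have hsub : Set.range f ⊆ Set.range j.left := hfr.trans_subset h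
  have hfac := IsOpenImmersion.lift_fac j.left f hsub
  have hw : f ≫ (specOver k R).hom = (specOver k B).hom := Over.w (specMap (IsScalarTower.toAlgHom k R B))
  refine ⟨Over.homMk (IsOpenImmersion.lift j.left f hsub) ?_, ?_, ?_, fun x hx => ?_⟩
  · rw [← Over.w j, ← Category.assoc]
    exact (congrArg (· ≫ (specOver k R).hom) hfac).trans hw
  · apply Over.OverMorphism.ext
    exact hfac
  · have : IsOpenImmersion (IsOpenImmersion.lift j.left f hsub ≫ j.left) := by
      rw [hfac]; exact hfo
    exact IsOpenImmersion.of_comp (IsOpenImmersion.lift j.left f hsub) j.left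
  · have hx' : j.left x ∈ Set.range f := by rw [hfr]; exact hx
    obtain ⟨y, hy⟩ := hx'
    refine ⟨y, ?_⟩
    apply (Scheme.Hom.isOpenEmbedding j.left).injective
    exact (congrArg (fun g : Spec (.of B) ⟶ Spec (.of R) => g y) hfac).trans hy

lemma finiteType_of_chart [LocallyOfFiniteType X.hom] (i : specOver k B ⟶ X)
    [IsOpenImmersion i.left] : Algebra.FiniteType k B := by
  have h : LocallyOfFiniteType (specOver k B).hom := by
    rw [← Over.w i]; infer_instance
  have h2 : LocallyOfFiniteType (Spec.map (CommRingCat.ofHom (algebraMap k B))) := h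
  rw [HasRingHomProperty.Spec_iff (P := @LocallyOfFiniteType)] at h2
  exact RingHom.finiteType_algebraMap.mp h2

/-- Normality is tested at maximal ideals, where the localizations of B are stalks of X. -/
lemma isIntegrallyClosed_of_chart [IsDomain B]
    (hX : ∀ x : X.left, IsIntegrallyClosed (X.left.presheaf.stalk x)) (i : specOver k B ⟶ X)
    [IsOpenImmersion i.left] : IsIntegrallyClosed B := by
  refine IsIntegrallyClosed.of_localization_maximal fun p _ hp => ?_
  let y : Spec (.of B) := (⟨p, hp.isPrime⟩ : PrimeSpectrum B)
  let f : Spec (.of B) ⟶ X.left := i.left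
  have hf : IsOpenImmersion f := inferInstanceAs (IsOpenImmersion i.left)
  have := hX (f y)
  have h1 : IsIntegrallyClosed ((Spec (.of B)).presheaf.stalk y) :=
    IsIntegrallyClosed.of_equiv (asIso (f.stalkMap y)).commRingCatIsoToRingEquiv
  let : Algebra B ((Spec (.of B)).presheaf.stalk y) := StructureSheaf.stalkAlgebra B y
  have h2 : IsLocalization.AtPrime ((Spec (.of B)).presheaf.stalk y) p :=
    StructureSheaf.IsLocalization.to_stalk B y
  exact IsIntegrallyClosed.of_equiv
    (IsLocalization.algEquiv p.primeCompl ((Spec (.of B)).presheaf.stalk y)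
      (Localization.AtPrime p)).toRingEquiv

end Chart

section Gluing

/-- The fractions b i / a i ^ n i agree on overlaps by `hab` and glue to σ. -/
lemma exists_glue {X : Scheme.{u}} {J : Type u} (a b : J → Γ(X, ⊤)) (n : J → ℕ)
    (hcov : ∀ x : X, ∃ i, x ∈ X.basicOpen (a i))
    (hab : ∀ i j, b i * a j ^ n j = b j * a i ^ n i) : ∃ σ : Γ(X, ⊤), ∀ i, σ * a i ^ n i = b i := by
  let U (i : J) : X.Opens := X.basicOpen (a i)
  let r (i : J) : Γ(X, ⊤) →+* Γ(X, U i) := (X.presheaf.map (homOfLE le_top).op).hom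
  have hunit (i : J) : IsUnit (r i (a i)) := X.toRingedSpace.isUnit_res_basicOpen (a i)
  choose c hc using fun i => (hunit i).exists_right_inv
  have hcov' : (⊤ : X.Opens) ≤ iSup U := fun x _ => by
    obtain ⟨i, hi⟩ := hcov x
    exact TopologicalSpace.Opens.mem_iSup.mpr ⟨i, hi⟩
  obtain ⟨σ₀, hσ, -⟩ := X.sheaf.existsUnique_gluing' U ⊤ (fun i => homOfLE le_top) hcov'
    (fun i => r i (b i) * c i ^ n i) (by
      intro i j
      let p := (X.presheaf.map (homOfLE (inf_le_left : U i ⊓ U j ≤ U i)).op).hom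
      let q := (X.presheaf.map (homOfLE (inf_le_right : U i ⊓ U j ≤ U j)).op).hom
      change p _ = q _
      have hpq (x : Γ(X, ⊤)) : p (r i x) = q (r j x) := by
        change (X.presheaf.map _ ≫ X.presheaf.map _).hom x =
          (X.presheaf.map _ ≫ X.presheaf.map _).hom x
        rw [← Functor.map_comp, ← Functor.map_comp]
        rfl
      have h1 : p (r i (a i)) * p (c i) = 1 := by rw [← map_mul, hc, map_one]
      have h2 : q (r j (a j)) * q (c j) = 1 := by rw [← map_mul, hc, map_one]
      have h3 := congrArg (fun x => q (r j x)) (hab i j)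
      simp only [map_mul, map_pow, ← hpq] at h3 h2 ⊢
      have h1' : p (r i (a i)) ^ n i * p (c i) ^ n i = 1 := by rw [← mul_pow, h1, one_pow]
      have h2' : p (r i (a j)) ^ n j * q (c j) ^ n j = 1 := by rw [← mul_pow, h2, one_pow]
      linear_combination (p (c i) ^ n i * q (c j) ^ n j) * h3 -
        p (r i (b i)) * p (c i) ^ n i * h2' + p (r i (b j)) * q (c j) ^ n j * h1')
  let σ : Γ(X, ⊤) := σ₀
  refine ⟨σ, fun i => ?_⟩
  refine X.sheaf.eq_of_locally_eq' U ⊤ (fun i => homOfLE le_top) hcov' _ _ fun j => ?_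
  change r j _ = r j _
  have h1 : r j σ = r j (b j) * c j ^ n j := hσ j
  have h2 := congrArg (r j) (hab i j)
  have h3 : r j (a j) ^ n j * c j ^ n j = 1 := by rw [← mul_pow, hc, one_pow]
  rw [map_mul, h1]
  simp only [map_mul, map_pow] at h2 ⊢
  linear_combination (-c j ^ n j) * h2 + r j (b i) * h3

end Gluing

end ToricGa

/-! ### Characters, localization, saturation and the monomial cover -/

namespace ToricGa

section Characters

/-- The nonzero group M/H has a nontrivial character into ℚ/ℤ. Its image is finitely generated and
torsion, hence finite, and k has enough roots of unity to separate a nonzero element of it from 0.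
-/
lemma exists_addChar_ne_one (k : Type*) [Field k] [IsAlgClosed k] [CharZero k] {M : Type*}
    [AddCommGroup M] [Module.Finite ℤ M] {H : AddSubgroup M} (hH : H ≠ ⊤) :
    ∃ h : AddChar M k, h ≠ 1 ∧ ∀ m ∈ H, h m = 1 := by
  obtain ⟨m, -, hm⟩ := SetLike.exists_of_lt hH.lt_top
  have hm0 : (QuotientAddGroup.mk m : M ⧸ H) ≠ 0 := by
    rwa [Ne, QuotientAddGroup.eq_zero_iff]
  obtain ⟨f, hf⟩ := CharacterModule.exists_character_apply_ne_zero_of_ne_zero hm0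
  let g : M →+ AddCircle (1 : ℚ) := AddMonoidHom.comp f (QuotientAddGroup.mk' H)
  have hgm : g m ≠ 0 := hf
  have hgH (x) (hx : x ∈ H) : g x = 0 := by
    change f (QuotientAddGroup.mk x) = 0
    rw [(QuotientAddGroup.eq_zero_iff x).mpr hx, map_zero]
  have : AddGroup.FG g.range := by
    have : AddGroup.FG M := Module.Finite.iff_addGroup_fg.mp inferInstance
    infer_instance
  have htor : IsAddTorsion g.range := by
    rintro ⟨x, -⟩
    obtain ⟨q, rfl⟩ := QuotientAddGroup.mk_surjective x
    refine isOfFinAddOrder_iff_nsmul_eq_zero.mpr ⟨q.den, q.den_pos, Subtype.ext ?_⟩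
    change ((q.den • q : ℚ) : AddCircle (1 : ℚ)) = 0
    rw [AddCircle.coe_eq_zero_iff]
    exact ⟨q.num, by simp [Rat.den_mul_eq_num]⟩
  have : Finite g.range := AddCommGroup.finite_of_fg_isAddTorsion _ htor
  obtain ⟨φ, hφ⟩ := CommGroup.exists_apply_ne_one_of_hasEnoughRootsOfUnity (Multiplicative g.range) k
    (a := Multiplicative.ofAdd ⟨g m, m, rfl⟩) (fun h => hgm (congrArg Subtype.val h))
  refine ⟨{ toFun := fun x => φ (Multiplicative.ofAdd (g.rangeRestrict x))
            map_zero_eq_one' := by simp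
            map_add_eq_mul' := fun a b => by simp }, fun h => hφ ?_, fun x hx => ?_⟩
  · exact Units.ext (DFunLike.congr_fun h m)
  · have : g.rangeRestrict x = 0 := Subtype.ext (hgH x hx)
    change ((φ (Multiplicative.ofAdd (g.rangeRestrict x)) : kˣ) : k) = 1
    rw [this]
    simp

end Characters

section Localization

variable {k : Type*} [Field k] {M : Type*} [AddCommGroup M] (S : AddSubmonoid M) (s : M)

/-- The algebra of `S.invert s` as an algebra over the algebra of `S`. -/
abbrev invertAlgebra : Algebra (AddMonoidAlgebra k S) (AddMonoidAlgebra k (S.invert s)) :=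
  (AddMonoidAlgebra.mapDomainAlgHom k k (AddSubmonoid.inclusion (S.le_invert s))).toRingHom.toAlgebra

attribute [local instance] invertAlgebra

lemma algebraMap_invert_single (u : S) (c : k) :
    algebraMap (AddMonoidAlgebra k S) (AddMonoidAlgebra k (S.invert s))
      (AddMonoidAlgebra.single u c) = AddMonoidAlgebra.single ⟨u, S.le_invert s u.2⟩ c :=
  AddMonoidAlgebra.mapDomain_single

lemma algebraMap_invert_injective : Function.Injective
    (algebraMap (AddMonoidAlgebra k S) (AddMonoidAlgebra k (S.invert s))) :=
  AddMonoidAlgebra.mapDomain_injective (AddSubmonoid.inclusion_injective (S.le_invert s))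

instance isScalarTower_invert :
    IsScalarTower k (AddMonoidAlgebra k S) (AddMonoidAlgebra k (S.invert s)) :=
  .of_algebraMap_eq' (AddMonoidAlgebra.mapDomainAlgHom k k
    (AddSubmonoid.inclusion (S.le_invert s))).comp_algebraMap.symm

instance isLocalization_invert (s : S) : IsLocalization.Away
    (AddMonoidAlgebra.single s (1 : k) : AddMonoidAlgebra k S)
    (AddMonoidAlgebra k (S.invert (s : M))) := by
  refine (isLocalization_iff _ _).mpr ⟨?_, fun z => ?_, fun {x y} h => ⟨1, ?_⟩⟩
  · rintro ⟨_, n, rfl⟩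
    simp only [map_pow, algebraMap_invert_single]
    refine IsUnit.pow n (IsUnit.of_mul_eq_one
      (AddMonoidAlgebra.single ⟨-s, S.neg_mem_invert s⟩ 1) ?_)
    rw [AddMonoidAlgebra.single_mul_single, AddMonoidAlgebra.one_def]
    congr 1
    · exact Subtype.ext (add_neg_cancel (s : M))
    · exact _root_.one_mul 1
  · suffices h : ∃ (n : ℕ) (x : AddMonoidAlgebra k S), z * algebraMap _ _
        (AddMonoidAlgebra.single s (1 : k) ^ n) = algebraMap _ _ x by
      obtain ⟨n, x, h⟩ := h
      exact ⟨(x, ⟨_, n, rfl⟩), h⟩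
    induction z using AddMonoidAlgebra.induction_linear with
    | zero => exact ⟨0, 0, by simp⟩
    | add z w hz hw =>
      obtain ⟨n, x, hx⟩ := hz
      obtain ⟨m, y, hy⟩ := hw
      refine ⟨n + m, x * AddMonoidAlgebra.single s (1 : k) ^ m +
        y * AddMonoidAlgebra.single s (1 : k) ^ n, ?_⟩
      rw [map_add, map_mul, map_mul, ← hx, ← hy, pow_add, map_mul]
      ring
    | single u c =>
      obtain ⟨n, hn⟩ := AddSubmonoid.mem_invert.mp u.2
      refine ⟨n, AddMonoidAlgebra.single ⟨u + n • (s : M), hn⟩ c, ?_⟩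
      rw [AddMonoidAlgebra.single_pow, algebraMap_invert_single, algebraMap_invert_single,
        AddMonoidAlgebra.single_mul_single, one_pow, _root_.mul_one]
      rfl
  · rw [algebraMap_invert_injective S (s : M) h]

end Localization

section Saturated

variable {k : Type u} [Field k] {M : Type u} [AddCommGroup M] {P : AddSubmonoid M}

lemma inclM_coeff_of_notMem (f : AddMonoidAlgebra k P) {m : M} (hm : m ∉ P) :
    (inclM k P f).coeff m = 0 := by
  induction f using AddMonoidAlgebra.induction_linear with
  | zero => simp
  | add f g hf hg => simp [hf, hg]
  | single u c =>
    have : (u : M) ≠ m := fun h => hm (h ▸ u.2)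
    simp [this, AddMonoidAlgebra.coeff_single]

lemma sub_mem_of_mul_single_eq {f : AddMonoidAlgebra k P} {p q : P}
    (h : f * AddMonoidAlgebra.single q 1 = AddMonoidAlgebra.single p 1) : (p - q : M) ∈ P := by
  have h1 := congrArg (fun x => inclM k P x * AddMonoidAlgebra.single (-q : M) (1 : k)) h
  simp only [map_mul, inclM_single, _root_.mul_assoc, AddMonoidAlgebra.single_mul_single,
    add_neg_cancel, _root_.mul_one, ← AddMonoidAlgebra.one_def, ← sub_eq_add_neg] at h1
  by_contra hm
  have h2 := inclM_coeff_of_notMem f hm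
  rw [h1] at h2
  simp [AddMonoidAlgebra.coeff_single] at h2

instance isDomain_addSubmonoid [Module.Free ℤ M] [Module.Finite ℤ M] : IsDomain (AddMonoidAlgebra k P) := by
  have : IsAddTorsionFree M := .of_isTorsionFree ℤ M
  have : AddMonoid.FG M :=
    AddGroup.fg_iff_addMonoid_fg.mp (Module.Finite.iff_addGroup_fg.mp inferInstance)
  exact (inclM_injective k P).isDomain (inclM k P).toRingHom

/-- If n(p - q) ∈ P, the fraction χ^p / χ^q has its n-th power in k[P], so it is integral and lies
in k[P]; comparing exponents gives p - q ∈ P. -/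
lemma isSaturated_of_isIntegrallyClosed [Module.Free ℤ M] [Module.Finite ℤ M]
    (hgen : ∀ m, ∃ p ∈ P, ∃ q ∈ P, m = p - q)
    (h : IsIntegrallyClosed (AddMonoidAlgebra k P)) : P.IsSaturated := by
  intro n m hn hm
  obtain ⟨p, hp, q, hq, rfl⟩ := hgen m
  let K := FractionRing (AddMonoidAlgebra k P)
  let c (u : P) : K := algebraMap (AddMonoidAlgebra k P) K (AddMonoidAlgebra.single u 1)
  have hc (u : P) : c u ≠ 0 := by
    rw [Ne, FaithfulSMul.algebraMap_eq_zero_iff]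
    simp
  have hpow : (c ⟨p, hp⟩ / c ⟨q, hq⟩) ^ n = c ⟨n • (p - q), hm⟩ := by
    rw [div_pow, div_eq_iff (pow_ne_zero _ (hc _))]
    simp only [c, ← map_pow, ← map_mul, AddMonoidAlgebra.single_pow, one_pow,
      AddMonoidAlgebra.single_mul_single, _root_.mul_one]
    congr 2
    refine Subtype.ext ?_
    simp [smul_sub]
  obtain ⟨z, hz⟩ := IsIntegrallyClosed.exists_algebraMap_eq_of_isIntegral_pow
    (R := AddMonoidAlgebra k P) hn (x := c ⟨p, hp⟩ / c ⟨q, hq⟩) (by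
      rw [hpow]; exact isIntegral_algebraMap)
  rw [eq_div_iff (hc _), ← map_mul] at hz
  exact sub_mem_of_mul_single_eq (p := ⟨p, hp⟩) (q := ⟨q, hq⟩)
    (FaithfulSMul.algebraMap_injective (AddMonoidAlgebra k P) K hz)

end Saturated

section Cover

variable {k : Type u} [Field k] {M : Type u} [AddCommGroup M]

/-- The complement of X is closed and stable under the torus, so its ideal is spanned by monomials.
Some function in the ideal is nonzero at x, hence so is one of its monomials, which again lies in
the ideal. -/
lemma exists_basicOpen_subset_locus [CharZero k] [Module.Free ℤ M] [Module.Finite ℤ M]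
    {S : AddSubmonoid M} {X : Over (Spec (.of k))} [ModObj (torus k M) X]
    (j : X ⟶ specOver k (AddMonoidAlgebra k S)) [IsOpenImmersion j.left]
    (hj : ∀ h : AddChar M k, actBy X (torusPoint h) ≫ j = j ≫ specMap (translate S h))
    (x : X.left) : ∃ s : S,
      AddMonoidAlgebra.single s (1 : k) ∉ (j.left x : PrimeSpectrum (AddMonoidAlgebra k S)).asIdeal ∧
      (PrimeSpectrum.basicOpen (AddMonoidAlgebra.single s (1 : k)) : Set _) ⊆ locus j := by
  have hopen : IsOpen (locus j) := (Scheme.Hom.isOpenEmbedding j.left).isOpen_range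
  obtain ⟨h, hh⟩ := exists_injective_addChar k M
  have hstab (z : PrimeSpectrum (AddMonoidAlgebra k S))
      (hz : PrimeSpectrum.comap (translate S h).toRingHom z ∈ locus j) : z ∈ locus j := by
    obtain ⟨w, hw⟩ := hz
    refine ⟨(actBy X (torusPoint h⁻¹)).left w, ?_⟩
    have h1 : j.left ((actBy X (torusPoint h⁻¹)).left w) =
        (specMap (translate S h⁻¹)).left (j.left w) :=
      congrArg (fun f => f.left w) (hj h⁻¹)
    rw [h1, hw]
    change PrimeSpectrum.comap (translate S h⁻¹).toRingHom _ = z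
    rw [← PrimeSpectrum.comap_comp_apply]
    exact congrArg (fun g => PrimeSpectrum.comap g z)
      (congrArg AlgHom.toRingHom (translate_translate_inv (k := k) S h))
  let I := PrimeSpectrum.vanishingIdeal (locus j)ᶜ
  have hI : PrimeSpectrum.zeroLocus (I : Set (AddMonoidAlgebra k S)) = (locus j)ᶜ := by
    rw [PrimeSpectrum.zeroLocus_vanishingIdeal_eq_closure, hopen.isClosed_compl.closure_eq]
  have hx : (j.left x : PrimeSpectrum (AddMonoidAlgebra k S)) ∉
      PrimeSpectrum.zeroLocus (I : Set (AddMonoidAlgebra k S)) := by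
    rw [hI]
    exact fun h => h ⟨x, rfl⟩
  obtain ⟨f, hf, hfx⟩ := Set.not_subset.mp hx
  obtain ⟨s, hs, hsx⟩ : ∃ s, f.coeff s ≠ 0 ∧ AddMonoidAlgebra.single s (1 : k) ∉
      (j.left x : PrimeSpectrum (AddMonoidAlgebra k S)).asIdeal := by
    by_contra! hcon
    apply hfx
    rw [← AddMonoidAlgebra.sum_coeff_single f]
    refine sum_mem fun m hm => ?_
    have := Ideal.mul_mem_left _ (algebraMap k _ (f.coeff m))
      (hcon m (Finsupp.mem_support_iff.mp hm))
    rwa [← Algebra.smul_def, AddMonoidAlgebra.smul_single, smul_eq_mul, _root_.mul_one] at this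
  refine ⟨s, hsx, ?_⟩
  have hsI := single_mem_of_stable (fun u : S => h u) (hh.comp Subtype.val_injective)
    (I.restrictScalars k) (translate S h) (translate_coeff h) (fun f hf => ?_) f hf s hs
  · rw [← compl_compl (locus j), ← hI, PrimeSpectrum.basicOpen_eq_zeroLocus_compl,
      Set.compl_subset_compl]
    exact PrimeSpectrum.zeroLocus_anti_mono (Set.singleton_subset_iff.mpr hsI)
  · refine (PrimeSpectrum.mem_vanishingIdeal _ _).mpr fun z hz => ?_
    exact (PrimeSpectrum.mem_vanishingIdeal _ _).mp hf _ fun hz' => hz (hstab z hz')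

end Cover

end ToricGa

/-! ### What faithfulness, finiteness, normality and gluing say about S -/

namespace ToricGa

variable {k : Type u} [Field k] {M : Type u} [AddCommGroup M]

/-- The isomorphism of affine schemes given by an isomorphism of algebras. -/
def specIso {A B : Type u} [CommRing A] [Algebra k A] [CommRing B] [Algebra k B] (e : A ≃ₐ[k] B) :
    specOver k B ≅ specOver k A where
  hom := specMap e.toAlgHom
  inv := specMap e.symm.toAlgHom
  hom_inv_id := by
    rw [← specMap_comp, ← specMap_id]
    congr 1
    exact AlgHom.ext e.apply_symm_apply
  inv_hom_id := by
    rw [← specMap_comp, ← specMap_id]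
    congr 1
    exact AlgHom.ext e.symm_apply_apply

/-- The spectrum of the algebra of the monoid of all characters is the torus. -/
def specIsoTorus {P : AddSubmonoid M} (hP : P = ⊤) :
    specOver k (AddMonoidAlgebra k P) ≅ torus k M :=
  specIso (AddMonoidAlgebra.domCongr k k (AddEquiv.ofBijective P.subtype
    ⟨Subtype.val_injective, fun m => ⟨⟨m, hP ▸ AddSubmonoid.mem_top m⟩, rfl⟩⟩)).symm

section Equivariant

variable {S : AddSubmonoid M} {X : Over (Spec (.of k))}
  {j : X ⟶ specOver k (AddMonoidAlgebra k S)}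

/-- If S generated a proper subgroup, a nontrivial torus point trivial on S would act trivially on
X. -/
lemma exists_sub_of_faithful [IsAlgClosed k] [CharZero k] [Module.Finite ℤ M]
    [ModObj (torus k M) X] [Mono j]
    (hj : ∀ h : AddChar M k, actBy X (torusPoint h) ≫ j = j ≫ specMap (translate S h))
    (hX : ∀ h : AddChar M k, actBy X (torusPoint h) = 𝟙 X → h = 1) (m : M) :
    ∃ p ∈ S, ∃ q ∈ S, m = p - q := by
  have hm : m ∈ AddSubgroup.closure (S : Set M) := by
    by_contra hcon
    obtain ⟨h, hh, hS⟩ := exists_addChar_ne_one k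
      (H := AddSubgroup.closure (S : Set M)) fun h => hcon (h ▸ AddSubgroup.mem_top m)
    refine hh (hX h ?_)
    rw [← cancel_mono j, hj, Category.id_comp]
    have : translate S h = AlgHom.id k _ := monoidAlgebra_algHom_ext fun u => by
      rw [translate_single, hS u (AddSubgroup.subset_closure u.2), _root_.mul_one]
      rfl
    rw [this, specMap_id, Category.comp_id]
  induction hm using AddSubgroup.closure_induction with
  | mem x hx => exact ⟨x, hx, 0, S.zero_mem, (sub_zero x).symm⟩
  | zero => exact ⟨0, S.zero_mem, 0, S.zero_mem, (sub_zero 0).symm⟩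
  | add x y _ _ hx hy =>
    obtain ⟨p, hp, q, hq, rfl⟩ := hx
    obtain ⟨p', hp', q', hq', rfl⟩ := hy
    exact ⟨p + p', S.add_mem hp hp', q + q', S.add_mem hq hq', by abel⟩
  | neg x _ hx =>
    obtain ⟨p, hp, q, hq, rfl⟩ := hx
    exact ⟨q, hq, p, hp, by abel⟩

lemma exists_finset_cover [CharZero k] [Module.Free ℤ M] [Module.Finite ℤ M]
    [ModObj (torus k M) X] [IsOpenImmersion j.left] [CompactSpace X.left]
    (hj : ∀ h : AddChar M k, actBy X (torusPoint h) ≫ j = j ≫ specMap (translate S h)) :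
    ∃ F : Finset S,
      (∀ s ∈ F, (PrimeSpectrum.basicOpen (AddMonoidAlgebra.single s (1 : k)) : Set _) ⊆ locus j) ∧
      ∀ x : X.left, ∃ s ∈ F, AddMonoidAlgebra.single s (1 : k) ∉
        (j.left x : PrimeSpectrum (AddMonoidAlgebra k S)).asIdeal := by
  classical
  choose s hs hsub using exists_basicOpen_subset_locus j hj
  obtain ⟨t, ht⟩ := CompactSpace.elim_nhds_subcover
    (fun x => j.left ⁻¹' (PrimeSpectrum.basicOpen (AddMonoidAlgebra.single (s x) (1 : k)) :
      Set (PrimeSpectrum (AddMonoidAlgebra k S))))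
    (fun x => ((PrimeSpectrum.basicOpen _).isOpen.preimage j.left.continuous).mem_nhds (hs x))
  refine ⟨t.image s, fun u hu => ?_, fun x => ?_⟩
  · obtain ⟨x, -, rfl⟩ := Finset.mem_image.mp hu
    exact hsub x
  · have hx : x ∈ (⊤ : Set X.left) := trivial
    rw [← ht] at hx
    obtain ⟨y, hy, hxy⟩ := Set.mem_iUnion₂.mp hx
    exact ⟨s y, Finset.mem_image_of_mem s hy, hxy⟩

attribute [local instance] invertAlgebra

lemma invert_fg [IsOpenImmersion j.left] [LocallyOfFiniteType X.hom] {s : S}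
    (hs : (PrimeSpectrum.basicOpen (AddMonoidAlgebra.single s (1 : k)) : Set _) ⊆ locus j) :
    (S.invert (s : M)).FG := by
  obtain ⟨i, -, hi, -⟩ := exists_chart (B := AddMonoidAlgebra k (S.invert (s : M))) j _ hs
  have := finiteType_of_chart i
  exact (AddMonoid.fg_iff_addSubmonoid_fg _).mp (AddMonoidAlgebra.fg_of_finiteType (R := k))

lemma invert_isSaturated [Module.Free ℤ M] [Module.Finite ℤ M] [IsOpenImmersion j.left]
    (hX : ∀ x : X.left, IsIntegrallyClosed (X.left.presheaf.stalk x))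
    (hgen : ∀ m, ∃ p ∈ S, ∃ q ∈ S, m = p - q) {s : S}
    (hs : (PrimeSpectrum.basicOpen (AddMonoidAlgebra.single s (1 : k)) : Set _) ⊆ locus j) :
    (S.invert (s : M)).IsSaturated := by
  obtain ⟨i, -, hi, -⟩ := exists_chart (B := AddMonoidAlgebra k (S.invert (s : M))) j _ hs
  refine isSaturated_of_isIntegrallyClosed (k := k) (fun m => ?_)
    (isIntegrallyClosed_of_chart hX i)
  obtain ⟨p, hp, q, hq, rfl⟩ := hgen m
  exact ⟨p, S.le_invert s hp, q, S.le_invert s hq, rfl⟩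

/-- If -s ∈ S[-t], then χ^s divides a power of χ^t, so D(χ^t) ⊆ D(χ^s). When this holds for all t ∈
F, the single chart of s is all of X, and it is Spec k[M]. -/
lemma nonempty_iso_torus [IsOpenImmersion j.left] [Nonempty X.left] (F : Finset S)
    (hF : ∀ s ∈ F, (PrimeSpectrum.basicOpen (AddMonoidAlgebra.single s (1 : k)) : Set _) ⊆ locus j)
    (hcov : ∀ x : X.left, ∃ s ∈ F, AddMonoidAlgebra.single s (1 : k) ∉
      (j.left x : PrimeSpectrum (AddMonoidAlgebra k S)).asIdeal)
    (htop : ∀ s ∈ F, S.invert (s : M) = ⊤) : Nonempty (X ≅ torus k M) := by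
  obtain ⟨s, hs, -⟩ := hcov (Classical.arbitrary _)
  obtain ⟨i, -, hi, hr⟩ :=
    exists_chart (B := AddMonoidAlgebra k (S.invert (s : M))) j _ (hF s hs)
  have hsurj : Function.Surjective i.left := fun x => hr x fun hx => by
    obtain ⟨t, ht, htx⟩ := hcov x
    have hmem : -(s : M) ∈ S.invert (t : M) := htop t ht ▸ AddSubmonoid.mem_top _
    obtain ⟨n, hn⟩ := AddSubmonoid.mem_invert.mp hmem
    apply htx
    refine PrimeSpectrum.isPrime (R := AddMonoidAlgebra k S) (j.left x) |>.mem_of_pow_mem n ?_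
    have : AddMonoidAlgebra.single t (1 : k) ^ n =
        AddMonoidAlgebra.single ⟨_, hn⟩ 1 * AddMonoidAlgebra.single s 1 := by
      rw [AddMonoidAlgebra.single_pow, AddMonoidAlgebra.single_mul_single, one_pow,
        _root_.mul_one]
      congr 1
      refine Subtype.ext ?_
      simp
    rw [this]
    exact Ideal.mul_mem_left _ _ hx
  have : Surjective i.left := ⟨hsurj⟩
  have : IsIso ((Over.forget (Spec (.of k))).map i) :=
    (isIso_iff_isOpenImmersion_and_surjective i.left).mpr ⟨hi, this⟩
  have : IsIso i := isIso_of_reflects_iso i (Over.forget _)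
  exact ⟨(asIso i).symm ≪≫ specIsoTorus (htop s hs)⟩

/-- On each chart χ^m is the fraction χ^{m + n s} / χ^{n s}. These fractions glue to a global
section, that is, an element of k[S], which forces m ∈ S. -/
lemma mem_of_forall_mem_invert [Nonempty X.left] (α : AddMonoidAlgebra k S ≃ₐ[k] Γ(X.left, ⊤))
    (F : Finset S) (hcov : ∀ x : X.left, ∃ s ∈ F, AddMonoidAlgebra.single s (1 : k) ∉
      ((toSpecGamma X ≫ specMap α.toAlgHom).left x :
        PrimeSpectrum (AddMonoidAlgebra k S)).asIdeal)
    (m : M) (hm : ∀ s ∈ F, m ∈ S.invert (s : M)) : m ∈ S := by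
  obtain ⟨s, hs, -⟩ := hcov (Classical.arbitrary _)
  choose n hn using fun i : F => AddSubmonoid.mem_invert.mp (hm i.1 i.2)
  obtain ⟨σ, hσ⟩ := exists_glue (fun i : F => α (AddMonoidAlgebra.single i.1 1))
    (fun i => α (AddMonoidAlgebra.single ⟨_, hn i⟩ 1)) n
    (fun x => by
      obtain ⟨t, ht, htx⟩ := hcov x
      exact ⟨⟨t, ht⟩, (mem_basicOpen_iff _ _).mpr htx⟩)
    (fun i l => by
      simp only [← map_pow, ← map_mul, AddMonoidAlgebra.single_pow, one_pow,
        AddMonoidAlgebra.single_mul_single, _root_.mul_one]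
      congr 2
      refine Subtype.ext ?_
      simp only [AddSubmonoid.coe_add, AddSubmonoidClass.coe_nsmul]
      abel)
  have h := congrArg α.symm (hσ ⟨s, hs⟩)
  simp only [map_mul, map_pow, AlgEquiv.symm_apply_apply, AddMonoidAlgebra.single_pow, one_pow] at h
  have := sub_mem_of_mul_single_eq h
  simpa using this

end Equivariant

end ToricGa

end

/-! ### Conclusion -/

theorem mainTheorem6 (k : Type u) [Field k] [IsAlgClosed k] [CharZero k]
    (M : Type u) [AddCommGroup M] [Module.Free ℤ M] [Module.Finite ℤ M]
    (X : Over (Spec (.of k))) [ModObj (ToricGa.torus k M) X]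
    (hX : ToricGa.IsToric (M := M) X) (hqa : X.left.IsQuasiAffine)
    (hT : IsEmpty (X ≅ ToricGa.torus k M)) :
    AddSubgroup.closure (ToricGa.weights (M := M) X) = ⊤ := by
  classical
  obtain ⟨S, α, hj⟩ := ToricGa.exists_equivariant_openImmersion X hX
  have := hX.isIntegral
  have := hX.locallyOfFiniteType
  set j := ToricGa.toSpecGamma X ≫ ToricGa.specMap α.toAlgHom with hjdef
  have hopen : IsOpenImmersion j.left := by
    have : IsIso (ToricGa.specMap α.toAlgHom).left :=
      inferInstanceAs (IsIso ((Over.forget _).map (ToricGa.specIso α).hom))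
    have : IsOpenImmersion (ToricGa.toSpecGamma X).left :=
      inferInstanceAs (IsOpenImmersion X.left.toSpecΓ)
    exact inferInstanceAs (IsOpenImmersion
      ((ToricGa.toSpecGamma X).left ≫ (ToricGa.specMap α.toAlgHom).left))
  have hΓ (f g : AddMonoidAlgebra k S →ₐ[k] AddMonoidAlgebra k S)
      (h : j ≫ ToricGa.specMap f = j ≫ ToricGa.specMap g) : f = g := by
    simp only [hjdef, Category.assoc, ← ToricGa.specMap_comp] at h
    have h1 := ToricGa.toSpecGamma_comp_injective h
    exact AlgHom.ext fun x => α.injective (DFunLike.congr_fun h1 x)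
  have hgen := ToricGa.exists_sub_of_faithful hj hX.faithful
  obtain ⟨F, hF, hcov⟩ := ToricGa.exists_finset_cover hj
  obtain ⟨s, hs, hne⟩ : ∃ s ∈ F, S.invert (s : M) ≠ ⊤ := by
    by_contra! htop
    exact (ToricGa.nonempty_iso_torus F hF hcov htop).elim hT.false
  obtain ⟨v, t, ht, hv, hS, hpos, hH⟩ := AddSubmonoid.exists_isRoot_generate hgen
    (F.image Subtype.val)
    (Finset.forall_mem_image.mpr fun s hs => ToricGa.invert_fg (hF s hs))
    (fun m hm => ToricGa.mem_of_forall_mem_invert α F hcov m fun s hs =>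
      hm _ (Finset.mem_image_of_mem _ hs))
    s.2 (Finset.mem_image_of_mem _ hs) (ToricGa.invert_isSaturated hX.normal hgen (hF s hs)) hne
  refine hH _ fun d hd => AddSubgroup.subset_closure ?_
  -- It remains to see D(χ^{s+t}) ⊆ X, which holds because D(χ^{s+t}) ⊆ D(χ^s).
  refine ToricGa.neg_mem_weights hS hd (S.add_mem s.2 ht) hv hpos j hj hΓ fun y hy => hF s hs ?_
  have : AddMonoidAlgebra.single (⟨s + t, S.add_mem s.2 ht⟩ : S) (1 : k) =
      AddMonoidAlgebra.single s 1 * AddMonoidAlgebra.single ⟨t, ht⟩ 1 := by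
    rw [AddMonoidAlgebra.single_mul_single, _root_.mul_one]
    rfl
  rw [this] at hy
  exact PrimeSpectrum.basicOpen_mul_le_left _ _ hy
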